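/- A positive integer $n$ is abundant if the sum of its aliquot parts (its positive divisors less than $n$) exceeds $n$. It is weird if it is abundant and no set of distinct aliquot parts of $n$ has sum $n$. It is primitive weird if it is weird and none of its aliquot parts is weird. (1) For each $k$ with $1\le k\le 14$, the pairs $(p,q)$ of odd primes $p<q$ such that $2^kpq$ is primitive weird are exactly the pairs in the following explicit list $T_k$: - $T_{1}$: $(5,7)$; - $T_{2}$: $(11,19)$; - $T_{3}$: $(17,127)$, $(19,61)$, $(19,71)$, $(23,43)$, $(29,31)$; - $T_{4}$: $(37,191)$, $(41,127)$, $(43,107)$; - $T_{5}$: $(67,887)$, $(67,971)$, $(67,1021)$, $(71,523)$, $(71,541)$, $(79,311)$, $(83,257)$, $(97,179)$, $(101,167)$, $(109,149)$; - $T_{6}$: $(131,3373)$, $(131,3733)$, $(131,4093)$, $(131,4159)$, $(137,1657)$, $(139,1447)$, $(139,1459)$, $(139,1471)$, $(149,839)$, $(149,853)$, $(151,761)$, $(151,773)$, $(157,643)$, $(157,659)$, $(167,509)$, $(167,521)$, $(179,433)$, $(191,367)$, $(191,373)$, $(191,379)$, $(239,271)$, $(241,257)$, $(251,257)$; - $T_{7}$: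 $(257,24029)$, $(257,25057)$, $(257,29683)$, $(257,30197)$, $(263,7561)$, $(263,8087)$, $(263,8317)$, $(269,4649)$, $(269,4861)$, $(271,4217)$, $(277,3109)$, $(281,2539)$, $(283,2557)$, $(307,1487)$, $(307,1493)$, $(307,1499)$, $(311,1399)$, $(317,1283)$, $(317,1303)$, $(337,1019)$, $(337,1031)$, $(337,1039)$, $(379,773)$, $(383,739)$, $(383,751)$, $(383,757)$, $(409,677)$, $(449,587)$, $(499,521)$; - $T_{8}$: $(521,24799)$, $(521,24851)$, $(521,25633)$, $(521,25841)$, $(521,25997)$, $(523,20789)$, $(523,20963)$, $(523,21617)$, $(523,22271)$, $(547,7673)$, $(547,7703)$, $(557,6151)$, $(557,6163)$, $(563,5077)$, $(563,5521)$, $(569,4561)$, $(569,4973)$, $(569,4993)$, $(569,5003)$, $(577,4423)$, $(577,4441)$, $(587,3923)$, $(587,3931)$, $(593,3659)$, $(593,3673)$, $(599,3457)$, $(619,2917)$, $(631,2671)$, $(631,2687)$, $(661,2251)$, $(673,2039)$, $(677,2039)$, $(677,2063)$, $(683,2017)$, $(683,2029)$, $(761,1543)$, $(761,1549)$, $(769,1499)$,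 $(769,1511)$, $(769,1523)$, $(787,1451)$, $(811,1381)$, $(839,1307)$, $(911,1163)$, $(919,1151)$, $(937,1123)$, $(947,1109)$, $(977,1069)$, $(997,1031)$, $(997,1033)$, $(1009,1031)$, $(1009,1033)$, $(1013,1031)$. The lists $T_9,\dots,T_{14}$, which contain $115, 210, 394, 683, 1389, 3118$ pairs, are written out number by number in the tables (definitions `weirdRows9`, …, `weirdRows14`) of the formal statement below, where a row $(p,[q_1,\dots,q_r])$ stands for the pairs $(p,q_1),\dots,(p,q_r)$. (2) The number of primitive weird numbers of the form $2^kpq$ with odd primes $p<q$ is $1, 1, 5, 3, 10, 23, 29, 53, 115, 210, 394, 683, 1389, 3118$ for $k=1,\dots,14$ respectively. (3) For every $k\ge1$ and all odd primes $p<q$, if $2^kpq$ is weird then it is primitive weird. (4) For all $k\ge1$, $m\ge1$ and every odd prime $p$, the number $2^kp^m$ is not weird. -/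

import Mathlib

/-- A natural number is primitive weird if it is weird (abundant, but not the sum of a set of its
proper divisors) and none of its aliquot parts (proper divisors) is weird. -/
def PrimitiveWeird (n : ℕ) : Prop :=
  n.Weird ∧ ∀ d ∈ n.properDivisors, ¬ d.Weird

/-- The set of all primitive weird numbers of the form `2 ^ k * p * q` with odd primes `p < q`. -/
def primitiveWeirdTwoPowMul (k : ℕ) : Set ℕ :=
  {n | PrimitiveWeird n ∧ ∃ p q : ℕ, p.Prime ∧ q.Prime ∧ Odd p ∧ Odd q ∧ p < q ∧ n = 2 ^ k * p * q}

/-! The tables. A row `(p, [q₁, …, qᵣ])` of the table for `k` lists the numbers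
`2 ^ k * p * q₁, …, 2 ^ k * p * qᵣ`; rows are ordered by `p`, and each row is increasing. -/

def weirdRows1 : List (ℕ × List ℕ) := [
  (5, [7])]

def weirdRows2 : List (ℕ × List ℕ) := [
  (11, [19])]

def weirdRows3 : List (ℕ × List ℕ) := [
  (17, [127]), (19, [61, 71]), (23, [43]), (29, [31])]

def weirdRows4 : List (ℕ × List ℕ) := [
  (37, [191]), (41, [127]), (43, [107])]

def weirdRows5 : List (ℕ × List ℕ) := [
  (67, [887, 971, 1021]), (71, [523, 541]), (79, [311]), (83, [257]), (97, [179]), (101, [167]),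
  (109, [149])]

def weirdRows6 : List (ℕ × List ℕ) := [
  (131, [3373, 3733, 4093, 4159]), (137, [1657]), (139, [1447, 1459, 1471]), (149, [839, 853]),
  (151, [761, 773]), (157, [643, 659]), (167, [509, 521]), (179, [433]), (191, [367, 373, 379]),
  (239, [271]), (241, [257]), (251, [257])]

def weirdRows7 : List (ℕ × List ℕ) := [
  (257, [24029, 25057, 29683, 30197]), (263, [7561, 8087, 8317]), (269, [4649, 4861]),
  (271, [4217]), (277, [3109]), (281, [2539]), (283, [2557]), (307, [1487, 1493, 1499]),
  (311, [1399]), (317, [1283, 1303]), (337, [1019, 1031, 1039]), (379, [773]), (383, [739, 751,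
  757]), (409, [677]), (449, [587]), (499, [521])]

def weirdRows8 : List (ℕ × List ℕ) := [
  (521, [24799, 24851, 25633, 25841, 25997]), (523, [20789, 20963, 21617, 22271]), (547, [7673,
  7703]), (557, [6151, 6163]), (563, [5077, 5521]), (569, [4561, 4973, 4993, 5003]), (577, [4423,
  4441]), (587, [3923, 3931]), (593, [3659, 3673]), (599, [3457]), (619, [2917]), (631, [2671,
  2687]), (661, [2251]), (673, [2039]), (677, [2039, 2063]), (683, [2017, 2029]), (761, [1543,
  1549]), (769, [1499, 1511, 1523]), (787, [1451]), (811, [1381]), (839, [1307]), (911, [1163]),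
  (919, [1151]), (937, [1123]), (947, [1109]), (977, [1069]), (997, [1031, 1033]), (1009, [1031,
  1033]), (1013, [1031])]

def weirdRows9 : List (ℕ × List ℕ) := [
  (1031, [121013, 121271, 122173, 124493, 131581, 131839]), (1033, [99581, 99787, 101027, 101957,
  103093, 103919, 104849]), (1039, [62989, 63443, 63703, 64223, 64937, 65327, 65521, 65651, 66041,
  66301, 66431]), (1049, [39821, 39983, 40063, 40507, 40709, 41233]), (1051, [37423, 37573]),
  (1061, [27893]), (1063, [26681, 26893, 26947]), (1069, [23773]), (1087, [17137, 17239, 17341]),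
  (1091, [16381]), (1093, [15817, 15973]), (1097, [15017, 15031, 15061, 15091]), (1109, [12211,
  13127]), (1117, [12049, 12073]), (1123, [11443]), (1129, [10853]), (1151, [9109, 9127, 9181,
  9199]), (1181, [7639]), (1223, [6151, 6163]), (1229, [6067, 6073, 6079, 6091]), (1231, [6007]),
  (1249, [5653]), (1259, [5441]), (1277, [5113]), (1279, [5051, 5081, 5101]), (1283, [5023]),
  (1289, [4933, 4957]), (1301, [4787]), (1303, [4751]), (1307, [4703]), (1319, [4549]),
  (1361, [4091, 4099, 4111]), (1367, [4049, 4057]), (1373, [4001, 4013]), (1427, [3613]),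
  (1447, [3491]), (1471, [3359]), (1481, [3307]), (1499, [3221]), (1511, [3167]), (1523, [3079,
  3109]), (1531, [3083]), (1543, [3023]), (1559, [2969]), (1601, [2833]), (1789, [2389]),
  (1811, [2351]), (1847, [2293]), (1861, [2269]), (1949, [2153]), (1979, [2111, 2113]),
  (1993, [2099]), (2011, [2053, 2063]), (2017, [2053, 2063, 2069]), (2027, [2053, 2063]),
  (2029, [2053, 2063]), (2039, [2053])]

def weirdRows10 : List (ℕ × List ℕ) := [
  (2053, [605977, 607003, 614531, 615557, 618637, 618979, 627191, 630613, 639167, 639851, 640193,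
  642931, 643273, 643957, 651143, 676463, 677147, 680569, 681253, 688097, 693571]), (2063, [249107,
  250267, 260453, 260969, 262387, 263677]), (2069, [184517, 185363, 185551, 185833, 188843, 189407,
  189877, 190159]), (2081, [123941, 124247, 124309]), (2083, [115837, 117053]), (2087, [104297,
  105341, 105863, 105967, 106019, 106123, 106541]), (2089, [99923, 100669, 100769, 101117]),
  (2099, [81457, 81901, 82183]), (2111, [66529, 67057, 67189, 67453]), (2129, [52627, 52757, 52783,
  52861, 53017, 53069, 53147]), (2131, [51169, 51473, 51803]), (2137, [48533]), (2141, [44983,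
  46327, 46441]), (2143, [45293, 45337, 45427]), (2153, [40927, 41231, 41333]), (2161, [38651,
  38803]), (2179, [33757, 33791]), (2203, [28723, 28751, 28879]), (2207, [28097, 28111]),
  (2237, [24077]), (2239, [23789, 23801]), (2251, [22543]), (2267, [21031]), (2269, [20921]),
  (2273, [20477, 20507]), (2287, [19477]), (2297, [18743]), (2309, [17987, 18013]), (2333, [16363,
  16649, 16657, 16673]), (2339, [16381]), (2341, [16267]), (2351, [15791]), (2371, [14957]),
  (2377, [14737]), (2381, [14321]), (2383, [14347, 14489, 14503]), (2389, [14243]),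
  (2393, [14143]), (2423, [13171]), (2437, [12791]), (2447, [12479, 12491]), (2459, [12211]),
  (2467, [12011]), (2551, [10259]), (2557, [10243, 10253]), (2579, [9923]), (2591, [9749]),
  (2593, [9721]), (2621, [9337]), (2659, [8893]), (2663, [8849]), (2671, [8753]), (2677, [8689,
  8693]), (2689, [8573]), (2707, [8387]), (2711, [8353]), (2713, [8191, 8293, 8297]), (2719, [8209,
  8221, 8233, 8237]), (2729, [8191]), (2731, [8101, 8117, 8161]), (2741, [8053]), (2803, [7589]),
  (2837, [7351]), (2843, [7307]), (2879, [7079]), (2917, [6863]), (2971, [6581]), (3023, [6337]),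
  (3049, [6143]), (3061, [6143, 6173]), (3067, [6143]), (3079, [6089, 6101]), (3083, [6079, 6091]),
  (3089, [6053]), (3163, [5801]), (3187, [5717]), (3209, [5653]), (3251, [5527]), (3253, [5521]),
  (3299, [5393]), (3469, [4993]), (3511, [4909]), (3607, [4733]), (3673, [4621]), (3739, [4523]),
  (3767, [4483]), (3797, [4441]), (3821, [4409]), (3881, [4327]), (3907, [4297]), (3917, [4283]),
  (3919, [4283]), (3929, [4271, 4273]), (3931, [4271]), (3947, [4241]), (3967, [4229]),
  (4013, [4157, 4159]), (4019, [4157, 4159]), (4021, [4157, 4159]), (4027, [4159]), (4049, [4099,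
  4111, 4127, 4129, 4133]), (4051, [4099, 4111, 4127, 4129, 4133]), (4057, [4099, 4111, 4127,
  4129]), (4073, [4099, 4111]), (4079, [4099])]

def weirdRows11Part1 : List (ℕ × List ℕ) := [
  (4099, [3368353, 3387823, 3417541, 3448283, 3486199, 3497471, 3507719, 3515917, 3532313, 3589699,
  3595847, 3650159, 3674753, 3677827, 3679877, 3712669, 3732139, 3751609, 3756733, 3773129,
  3778253, 3792599, 3797723, 3817193, 3822317, 3827441, 3841787, 3874579, 3896099, 3899173,
  3901223, 3945287, 3948361, 3989351, 3997549, 3999599, 4007797, 4019069, 4022143, 4024193,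
  4038539, 4046737, 4063133, 4068257, 4081579, 4101049, 4112321, 4147163, 4186103, 4191227,
  4194301]), (4111, [992549, 996403, 1009507, 1014389, 1022611, 1026979, 1027493, 1028263, 1028777,
  1031347, 1040339]), (4127, [512521, 512779, 522323, 522839, 523097, 524257, 526063, 526837,
  527353, 527869, 528127]), (4129, [487829, 489043, 489407, 489529, 491593, 494387]),
  (4133, [435161, 436357, 437771, 438533, 439511, 439729, 443753, 444079, 444623, 444841]),
  (4139, [376837, 376931, 380129, 382763]), (4153, [288991, 289063, 289349, 290137, 290351,
  291569]), (4157, [271277, 272417, 273289, 274093]), (4159, [264031, 264811, 266111]),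
  (4177, [206303, 207169, 208391, 208493]), (4201, [161461, 161659, 162293]), (4211, [147457,
  148147]), (4217, [140681, 141131, 141269, 141511]), (4229, [128321]), (4231, [126743, 126961,
  127241]), (4241, [118399, 118457]), (4243, [116797, 116911, 116969]), (4253, [110039]),
  (4259, [102241, 105929, 106033, 106163, 106189, 106319]), (4261, [104651, 104779, 104933,
  104959]), (4271, [99349]), (4283, [92927]), (4289, [90511, 90533]), (4297, [86939]),
  (4327, [76207]), (4339, [72767]), (4349, [69857]), (4357, [65371]), (4363, [66617]),
  (4373, [64399]), (4397, [59621]), (4409, [57331, 57373, 57457]), (4421, [55411]),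
  (4441, [52457]), (4447, [51607, 51683, 51721]), (4451, [51199]), (4463, [49177, 49663]),
  (4481, [47491]), (4483, [47221, 47279]), (4493, [46171, 46183]), (4507, [44741]), (4513, [44179,
  44201]), (4517, [43789]), (4519, [43591, 43633]), (4547, [40933, 40973, 40993, 41023]),
  (4549, [40961, 41011]), (4561, [40031]), (4591, [37847]), (4603, [36833, 36887, 36923]),
  (4639, [34877]), (4649, [34313]), (4651, [34213]), (4663, [33601, 33617]), (4673, [32719, 32783,
  33107]), (4679, [32801]), (4691, [32191]), (4703, [31667]), (4721, [30859]), (4729, [30529]),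
  (4733, [30341]), (4783, [28447]), (4787, [28279]), (4799, [27901]), (4801, [27847]),
  (4831, [26879]), (4871, [25679]), (4903, [24551, 24593, 24763, 24781]), (4909, [24551, 24593,
  24611, 24623, 24659, 24671, 24677, 24683]), (4919, [24439]), (4937, [23993]), (4943, [23869]),
  (4957, [23531, 23537]), (4987, [22877]), (4999, [22639]), (5009, [22441]), (5021, [22193]),
  (5023, [22159]), (5087, [20983]), (5099, [20771]), (5101, [20743, 20753]), (5107, [20483, 20533,
  20599, 20639]), (5113, [20477, 20507]), (5119, [20341, 20411, 20431, 20441]), (5179, [19559]),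
  (5189, [19423]), (5227, [18899]), (5279, [18253]), (5281, [18229]), (5297, [18041]),
  (5309, [17903]), (5381, [17117]), (5441, [16411, 16553]), (5443, [16381, 16417, 16421, 16433]),
  (5449, [16411, 16427, 16447, 16451]), (5471, [16273]), (5477, [16189, 16193]), (5479, [16187]),
  (5507, [15959, 15971]), (5519, [15859]), (5531, [15761]), (5569, [15467]), (5659, [14813]),
  (5783, [14029]), (5801, [13921]), (5821, [13807]), (5897, [13397]), (5927, [13241]),
  (5981, [12979, 12983]), (6043, [12703]), (6053, [12659]), (6067, [12589]), (6073, [12569]),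
  (6079, [12547]), (6091, [12487]), (6101, [12451]), (6113, [12289, 12301, 12377, 12401]),
  (6121, [12323, 12329, 12347]), (6131, [12289, 12301]), (6133, [12323]), (6143, [12211, 12241,
  12253, 12277]), (6151, [12197, 12203, 12227, 12239, 12251]), (6163, [12197, 12203]),
  (6173, [12161]), (6197, [12049]), (6203, [12041, 12049]), (6211, [12011]), (6229, [11941,
  11953]), (6247, [11887]), (6263, [11821]), (6271, [11801]), (6277, [11777]), (6323, [11621]),
  (6389, [11399]), (6449, [11213]), (6491, [11093]), (6529, [10979]), (6563, [10889]),
  (6571, [10867]), (6637, [10691]), (6689, [10559]), (6701, [10529]), (6917, [10037]),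
  (6983, [9901]), (7019, [9829]), (7039, [9791]), (7069, [9733]), (7213, [9473]), (7243, [9421]),
  (7321, [9293]), (7331, [9277])]

def weirdRows11Part2 : List (ℕ × List ℕ) := [
  (7451, [9091]), (7507, [9007]), (7559, [8933]), (7561, [8933]), (7607, [8867]), (7643, [8821]),
  (7673, [8779]), (7691, [8753]), (7699, [8747]), (7727, [8707]), (7757, [8669]), (7759, [8669]),
  (7793, [8627, 8629]), (7829, [8581]), (7883, [8521]), (7951, [8443]), (8009, [8377]),
  (8011, [8377]), (8053, [8317, 8329]), (8081, [8287, 8291, 8293, 8297]), (8087, [8287, 8291,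
  8293]), (8089, [8287, 8291, 8293]), (8093, [8287]), (8101, [8191]), (8111, [8191, 8209]),
  (8117, [8191, 8209, 8219, 8221]), (8123, [8191, 8209, 8219, 8221, 8231, 8233, 8237, 8243]),
  (8147, [8191, 8209, 8219, 8221, 8231, 8233]), (8161, [8191, 8209, 8219]), (8167, [8191, 8209]),
  (8171, [8191, 8209]), (8179, [8191])]

def weirdRows11 : List (ℕ × List ℕ) :=
  weirdRows11Part1 ++ weirdRows11Part2

def weirdRows12Part1 : List (ℕ × List ℕ) := [
  (8209, [3541271, 3545831, 3556321, 3557689, 3606487, 3608767, 3610591, 3637043, 3639323, 3641147,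
  3642971, 3643883, 3644339, 3654829, 3655741, 3658021, 3658477, 3687209, 3690857, 3691313,
  3692681, 3703171, 3705451, 3706819, 3708643]), (8219, [2329499, 2339773, 2343589, 2344469,
  2348579, 2352101, 2354743, 2355037, 2355917, 2360027, 2366191, 2370007, 2373529, 2373823,
  2374997, 2389967]), (8221, [2181031, 2182949, 2183771, 2184319, 2196377, 2197747, 2198569,
  2198843, 2202131, 2211997, 2212271, 2213093, 2228713, 2228987, 2229809, 2234741]),
  (8231, [1650109, 1650521, 1651961, 1654019, 1663073, 1667189, 1668629, 1670687, 1674391, 1675831,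
  1676243, 1679329, 1682827, 1683239, 1684679, 1685297, 1685503]), (8233, [1573483, 1573679,
  1574071, 1575443, 1577599, 1579363, 1579951, 1592693, 1593281, 1594261, 1594849, 1595437,
  1605631]), (8237, [1438609, 1439147, 1442191, 1442549, 1445593, 1450249, 1453651, 1455263,
  1457411, 1460993, 1461709, 1465469]), (8243, [1288919, 1291139, 1291931, 1293199, 1294309,
  1298113]), (8263, [929587, 932227, 932341, 933259, 934981, 935899, 938309, 940031]),
  (8269, [857749, 859657]), (8273, [818219, 821851, 824777, 826391]), (8287, [702323, 703013,
  703531, 704567, 704999, 705689, 706207, 707071]), (8291, [673063, 673643, 678037, 678203,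
  678949]), (8293, [662789, 663683, 664009, 664253]), (8297, [635659, 640043, 640121, 640669]),
  (8311, [562931, 564593, 565771, 565909, 565979, 566879]), (8329, [491531, 491773, 491833, 492799,
  493463, 493523, 493583]), (8353, [420073, 420331, 420743, 421207, 421517]), (8363, [393109,
  398117]), (8369, [383281, 383657, 384691]), (8377, [367597, 367687, 367777, 367867, 367957,
  368047, 368227, 368633]), (8387, [349387, 349729]), (8389, [345431, 345601, 345643, 346321,
  347041]), (8419, [301237, 301459, 301643, 302123]), (8423, [296729, 296801, 296983, 297019]),
  (8429, [289171, 290021]), (8431, [287251, 287321]), (8443, [270209, 273727, 273827]),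
  (8447, [269281, 269413, 270073, 270271]), (8461, [256117, 256211, 256493]), (8467, [250451,
  250543, 250727, 251003]), (8501, [224069, 224261, 224563]), (8513, [212851, 216023, 216103]),
  (8521, [210907, 211217, 211501]), (8527, [207287, 207541, 207769]), (8537, [201557, 201581,
  202001, 202099]), (8539, [200789]), (8543, [198479, 198503, 198673]), (8573, [180077, 183511,
  183691, 183713]), (8597, [173189]), (8599, [171937, 172001, 172127, 172169, 172633]),
  (8623, [163337, 163417, 163477]), (8627, [162053]), (8641, [157189]), (8647, [155171, 155209]),
  (8663, [147289, 150097, 150299]), (8669, [147391, 147409, 147481, 148279]), (8677, [145991,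
  146009]), (8681, [145043]), (8689, [142757, 142897]), (8699, [139201, 139303, 140057, 140177]),
  (8707, [138113, 138181]), (8713, [136537, 136603]), (8731, [132371, 132403]), (8737, [131071]),
  (8747, [128813]), (8753, [127541]), (8761, [125743, 125789, 125897]), (8779, [122219, 122263]),
  (8783, [121493]), (8819, [114689, 114773, 114913, 114941]), (8831, [112967, 113023]),
  (8837, [111953]), (8861, [108223, 108289]), (8863, [107951]), (8867, [106417, 107309]),
  (8887, [104473, 104537, 104549]), (8923, [99823]), (8929, [98327, 98981, 98993, 99017, 99041,
  99053]), (8933, [98299, 98323, 98347, 98407, 98419, 98443, 98467, 98479, 98491, 98563]),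
  (8963, [94993, 95063]), (8971, [94207]), (8999, [90023, 90067, 91159]), (9007, [90191, 90379,
  90401]), (9011, [89923, 89989, 90011]), (9013, [89779]), (9043, [86927]), (9067, [84697]),
  (9091, [81839, 81869, 81899, 82657]), (9103, [81637, 81647, 81667, 81677, 81707, 81727, 81737]),
  (9109, [81197]), (9127, [79841, 79861]), (9137, [79103]), (9151, [78031, 78059, 78079]),
  (9161, [77339]), (9199, [74687]), (9209, [73681, 73699, 73771, 73961, 74051]), (9227, [72907]),
  (9241, [72053]), (9257, [71129]), (9281, [69709]), (9293, [69031, 69073]), (9311, [68053]),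
  (9323, [67427]), (9341, [66491, 66499]), (9343, [66431]), (9349, [65539]), (9371, [65033]),
  (9397, [63799, 63823]), (9413, [63079]), (9431, [62297]), (9463, [60899]), (9467, [60763]),
  (9479, [60251, 60259]), (9491, [59771]), (9511, [58997, 59011]), (9533, [58171]), (9547, [57373,
  57641]), (9551, [57383, 57397, 57467]), (9587, [56237]), (9619, [55147]), (9643, [54371]),
  (9649, [54181]), (9677, [53327]), (9679, [53267]), (9697, [52721]), (9749, [51229, 51241]),
  (9769, [50683]), (9781, [50387]), (9791, [50111, 50123]), (9803, [49787, 49811]), (9811, [49139,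
  49157]), (9817, [49139, 49157, 49169, 49193, 49199, 49211, 49223, 49429]), (9833, [48973, 48991,
  49003, 49009, 49033]), (9871, [48109, 48121]), (9883, [47797, 47837, 47843]), (9941, [46523]),
  (9949, [46349]), (9973, [45841]), (10007, [45119]), (10037, [44519]), (10039, [44491]),
  (10061, [44053]), (10067, [43943]), (10079, [43711, 43721]), (10163, [42187]), (10169, [42089]),
  (10211, [41389]), (10223, [41017, 41047, 41143, 41183, 41203]), (10243, [40787, 40847, 40867]),
  (10247, [40813, 40823]), (10253, [40639]), (10259, [40609]), (10267, [40499]), (10271, [40427]),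
  (10301, [39983]), (10303, [39929, 39953]), (10333, [39503]), (10343, [39367]), (10357, [39161]),
  (10399, [38567])]

def weirdRows12Part2 : List (ℕ × List ℕ) := [
  (10453, [37847]), (10457, [37799]), (10529, [36887]), (10559, [36523]), (10597, [36067]),
  (10639, [35593]), (10657, [35393]), (10663, [35323, 35327]), (10667, [35279]), (10691, [35023,
  35027]), (10739, [34513]), (10837, [33547]), (10853, [33349]), (10859, [33317, 33329]),
  (10861, [33311]), (10883, [33073, 33113]), (10889, [32771, 32993]), (10891, [32789, 32983, 32987,
  32999, 33023]), (10903, [32789, 32797, 32801, 32833, 32869]), (10909, [32771, 32779, 32783,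
  32803, 32831, 32839, 32843]), (10937, [32611]), (10949, [32497]), (10957, [32411, 32423, 32443]),
  (10973, [32299, 32303]), (10979, [32251]), (10987, [32159]), (11047, [31667]), (11161, [30781]),
  (11279, [29917]), (11383, [29209]), (11399, [29101]), (11411, [29023, 29027]), (11423, [28949]),
  (11447, [28793]), (11483, [28571]), (11519, [28351]), (11587, [27943, 27947]), (11621, [27751]),
  (11677, [27437]), (11689, [27367]), (11731, [27143]), (11777, [26893]), (11813, [26711]),
  (11863, [26459]), (11971, [25933]), (12041, [25601]), (12097, [25367]), (12161, [25087]),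
  (12163, [25057]), (12197, [24917, 24923]), (12203, [24889, 24907]), (12211, [24859, 24877]),
  (12227, [24793, 24799]), (12241, [24593, 24611]), (12251, [24631]), (12253, [24593, 24611, 24623,
  24659, 24671, 24677, 24683]), (12263, [24631]), (12269, [24631]), (12277, [24593, 24611]),
  (12289, [24419, 24443, 24473, 24509, 24527, 24533, 24551]), (12301, [24443, 24473, 24509]),
  (12323, [24407, 24413, 24419]), (12343, [24317, 24329]), (12347, [24281]), (12401, [24121]),
  (12409, [24091, 24097]), (12421, [24043, 24049]), (12433, [24001, 24007]), (12451, [23917]),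
  (12457, [23909]), (12503, [23747]), (12541, [23603]), (12547, [23593]), (12653, [23227]),
  (12671, [23167]), (12713, [23027]), (12739, [22943]), (12799, [22751]), (12821, [22679]),
  (12829, [22651]), (12841, [22619]), (12899, [22441]), (12919, [22381]), (12923, [22369]),
  (13003, [22133]), (13177, [21647]), (13421, [21019]), (13523, [20773]), (13619, [20551]),
  (13627, [20533]), (13649, [20483]), (13681, [20411]), (13691, [20389]), (13721, [20323]),
  (14107, [19531]), (14143, [19463]), (14153, [19441]), (14159, [19433]), (14281, [19207]),
  (14293, [19183]), (14519, [18793]), (14549, [18743]), (14591, [18671]), (14639, [18593]),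
  (14827, [18301]), (14939, [18133]), (14947, [18119, 18121]), (14969, [18089]), (15061, [17957]),
  (15073, [17939]), (15077, [17929]), (15083, [17923]), (15241, [17707]), (15259, [17683]),
  (15277, [17659]), (15299, [17627]), (15359, [17551]), (15383, [17519]), (15391, [17509]),
  (15461, [17417, 17419]), (15607, [17231]), (15647, [17189]), (15683, [17137]), (15727, [17093]),
  (15737, [17077]), (15739, [17077]), (15761, [17047, 17053]), (15773, [17033]), (15787, [17021]),
  (15797, [17011]), (15809, [16993]), (15823, [16979, 16981]), (15913, [16879]), (15959, [16823]),
  (16061, [16699, 16703]), (16063, [16699, 16703]), (16067, [16703]), (16069, [16703]),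
  (16073, [16703]), (16087, [16673]), (16091, [16673]), (16097, [16673]), (16141, [16603, 16607]),
  (16183, [16561, 16567, 16573]), (16187, [16561, 16567, 16573]), (16189, [16561, 16567, 16573]),
  (16193, [16567, 16573]), (16223, [16519]), (16229, [16519, 16529]), (16231, [16519, 16529])]

def weirdRows12Part3 : List (ℕ × List ℕ) := [
  (16273, [16411, 16417, 16421]), (16301, [16411, 16417, 16421, 16427, 16433, 16447, 16451,
  16453]), (16319, [16411, 16417, 16421, 16427, 16433]), (16333, [16411, 16417, 16421, 16427]),
  (16339, [16411, 16417, 16421]), (16349, [16411])]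

def weirdRows12 : List (ℕ × List ℕ) :=
  weirdRows12Part1 ++ weirdRows12Part2 ++ weirdRows12Part3

def weirdRows13Part1 : List (ℕ × List ℕ) := [
  (16411, [9272801, 9273973, 9275731, 9305623, 9316759, 9319103, 9328481, 9330239, 9350753,
  9363061, 9363647, 9372439, 9381817, 9385919, 9392953, 9416983, 9418741, 9419327, 9428119,
  9438083, 9441599, 9450977, 9471491, 9480283, 9503141, 9504899, 9506657, 9525413, 9527171,
  9547099, 9558821, 9559993, 9569957, 9571129, 9578749, 9593401, 9601607]), (16417, [7686053,
  7687501, 7695227, 7696193, 7705367, 7714541, 7722749, 7726129, 7734821, 7736269, 7738201,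
  7748341, 7773449, 7793729, 7797109, 7816423, 7823183, 7827529, 7831391, 7833323, 7841531,
  7843463, 7861811, 7875331, 7890299, 7895611, 7910579]), (16421, [6902437, 6903301, 6920587,
  6921451, 6921883, 6939601, 6940033, 6952997, 6954293, 6955589, 6962071, 6973739, 6974171,
  6975467, 6979789, 6980221, 6992753, 6994049, 6994913, 7012199, 7013063, 7013927, 7034669,
  7038127, 7040287, 7051523, 7059733, 7077883]), (16427, [5980921, 5985401, 5994361, 5995481,
  5997721, 6002201, 6030949, 6032069, 6035429, 6042149, 6045509, 6061189, 6069029, 6069403,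
  6072389, 6079483, 6083963, 6094043, 6106363, 6109723]), (16433, [5294383, 5299313, 5300299,
  5305229, 5314103, 5317061, 5326921, 5330207, 5340067, 5342039, 5345983, 5362087, 5363731,
  5367017, 5368003, 5368661, 5370961, 5372933, 5375891]), (16447, [4150297, 4152353, 4154923,
  4158521, 4160063, 4162889, 4169057, 4170599, 4172141, 4173683, 4174711, 4176253, 4178051,
  4180621, 4182163, 4187303, 4197839, 4200923, 4204007, 4205549, 4206577]), (16451, [3909289,
  3923321, 3924047, 3924289, 3929369, 3930337, 3931547, 3935417, 3936869, 3937111, 3938321,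
  3950417, 3950659, 3955013, 3957433, 3962029]), (16453, [3797117, 3801583, 3802523, 3802993,
  3809339, 3809809, 3818741, 3822031, 3822737, 3823207, 3824147, 3824617, 3825557, 3826967,
  3827437, 3830023, 3830963, 3834959, 3847651, 3848591, 3849061, 3850237]), (16477, [2841931,
  2844911, 2845963, 2850871, 2851397, 2852449, 2854903, 2855429, 2857181, 2857357, 2860337,
  2860687, 2861213, 2866121, 2867699]), (16481, [2727941, 2729119, 2729959, 2732987, 2733827,
  2739713, 2741059, 2741227, 2744591, 2745263, 2746609, 2747449, 2750981]), (16487, [2575301,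
  2577203, 2579581, 2580691, 2583703, 2585129, 2588141, 2590361, 2591153, 2591471, 2592263]),
  (16493, [2441563, 2442463, 2443213, 2446061, 2446811, 2447111, 2455207, 2455507, 2455657,
  2456107, 2456407]), (16519, [1978393, 1979729, 1981429, 1982401, 1982887, 1983859, 1984709,
  1988353, 1988839, 1989203]), (16529, [1843549, 1843889, 1844681, 1846153, 1846379, 1848983,
  1849663, 1851587, 1852153, 1852493, 1853399]), (16547, [1643197, 1645417, 1646527, 1647031,
  1649251, 1650563, 1651471]), (16553, [1588211, 1588309, 1593859]), (16561, [1516261, 1517099,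
  1517843, 1518773, 1521937, 1522681, 1523891, 1524077]), (16567, [1474643, 1475003]),
  (16573, [1421963, 1422661, 1423969, 1424231, 1425539, 1426063, 1426237, 1426499, 1426673,
  1428767]), (16603, [1232999, 1233301, 1233527, 1235263, 1235791, 1236017]), (16619, [1146781,
  1149457, 1149527, 1151147, 1151569]), (16631, [1094963, 1095433, 1097377]), (16633, [1089461,
  1089661]), (16649, [1021973, 1022849, 1023037]), (16651, [1014779, 1015897, 1016083, 1016891,
  1017077]), (16657, [993401, 993827, 993887, 995833]), (16661, [978683, 978743, 978863, 979103,
  979163, 979283, 979343, 979403]), (16673, [938747, 939839, 940127, 940529, 940759, 940817,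
  941449, 941737]), (16691, [885869, 885923, 885977, 886031, 886519, 887657]), (16693, [879667,
  879721, 880151, 880259, 880367, 880421]), (16699, [863539, 863803, 863909, 865177]),
  (16703, [851957, 852583, 854149, 855089]), (16729, [786311, 790421, 791291, 791629]),
  (16741, [764053, 764521, 765409, 765503, 766111]), (16747, [753707]), (16759, [728437, 728659,
  728927, 728971, 729373, 729551, 729907]), (16763, [721117]), (16787, [679333, 680039, 680081]),
  (16811, [638857, 643099, 643217]), (16823, [622603, 625777, 626159, 626389]), (16829, [617579,
  617767, 617843, 618031]), (16831, [614293, 615233]), (16843, [598841, 599281, 599537]),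
  (16871, [565489, 565973, 566077]), (16879, [557041, 557449, 557483]), (16883, [552749]),
  (16889, [546289]), (16901, [533719, 534241, 534371]), (16903, [531631, 531989, 532249, 532379]),
  (16921, [514643, 514769]), (16927, [508867, 508961, 509023, 509147, 509521]), (16931, [505643]),
  (16937, [500069]), (16943, [491377, 494917, 495401, 495461, 495491, 495613]), (16963, [478853,
  479029]), (16979, [466153, 466181, 466267, 466409, 466637, 466723]), (16981, [458543, 464819]),
  (16987, [458789, 460111, 460477, 460561, 460589, 460673]), (16993, [455941, 455969]),
  (17011, [442069, 442177, 442367, 443369, 443423]), (17021, [436463]), (17027, [433051]),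
  (17029, [431287, 431339, 431603, 431867]), (17033, [425851, 425903, 428759]), (17041, [423823]),
  (17047, [420193]), (17077, [402613, 402761, 402859]), (17093, [393187, 393331, 393403, 393451]),
  (17099, [391103, 391151, 391199, 391247]), (17107, [386963]), (17117, [381937]),
  (17123, [376729]), (17137, [372013, 372059, 372241, 372263]), (17159, [362107]), (17167, [358601,
  358667, 358711, 358733]), (17189, [349303]), (17191, [348181, 348287]), (17203, [343661]),
  (17207, [341863, 341947]), (17209, [341179]), (17231, [332611]), (17239, [327661]),
  (17257, [323341, 323381]), (17291, [311009, 311123, 311371, 311447, 311561]), (17293, [311197,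
  311293]), (17317, [303473, 303529]), (17333, [298693]), (17341, [294869, 294887, 294923, 296299,
  296353]), (17359, [291367]), (17383, [284681]), (17389, [282977, 283133]), (17393, [281887,
  281921, 282059]), (17401, [278501, 279817]), (17417, [275741]), (17431, [272359]),
  (17443, [269461, 269527, 269543]), (17449, [268069]), (17467, [262069, 262133, 263761]),
  (17471, [262193, 262321, 262337, 262819, 262883]), (17477, [261563, 261643, 261707]),
  (17489, [258871, 258887, 258919]), (17491, [258607, 258623]), (17497, [257161, 257177, 257287]),
  (17539, [245621]), (17551, [245593, 245653, 245759, 245789, 245849, 245909, 246119]),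
  (17569, [242603, 242647, 242677]), (17573, [241783, 241931]), (17579, [240623]),
  (17581, [240263]), (17597, [237313]), (17599, [236993]), (17623, [232751]), (17627, [232013]),
  (17657, [226907]), (17681, [223151]), (17713, [218069, 218149]), (17729, [215737]),
  (17737, [212909, 214481, 214507]), (17747, [213029, 213133]), (17749, [212507]), (17783, [207997,
  208073, 208099]), (17807, [204793]), (17827, [202183]), (17839, [200639, 200713]),
  (17851, [199109]), (17863, [196613, 196661, 197651, 197699]), (17881, [195497]),
  (17891, [194309]), (17909, [192187]), (17923, [190577]), (17929, [189901, 189947]),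
  (17939, [188843]), (17957, [186871]), (17959, [186689]), (17971, [185323]), (17977, [184687,
  184721]), (17981, [184333]), (17987, [183637]), (17989, [183451]), (18013, [180317, 181003]),
  (18049, [177467]), (18061, [176261]), (18089, [173669]), (18119, [170971]), (18121, [170741,
  170773]), (18127, [170231]), (18131, [169889]), (18133, [169693]), (18143, [168863]),
  (18169, [166603, 166613])]

def weirdRows13Part2 : List (ℕ × List ℕ) := [
  (18191, [163789, 163819, 163859]), (18199, [163841, 163861, 163871, 163901, 163981, 163991,
  164011, 164051, 164071]), (18211, [163151, 163171, 163181, 163211]), (18217, [162671, 162691,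
  162731]), (18229, [161779]), (18257, [159539]), (18269, [158647, 158657]), (18287, [157321]),
  (18311, [155539]), (18313, [155413, 155423]), (18371, [151357]), (18401, [149323, 149341]),
  (18413, [148537, 148573]), (18427, [147551]), (18433, [147221, 147293, 147311]), (18439, [146857,
  146893]), (18443, [146639]), (18461, [145511]), (18481, [144271, 144289]), (18503, [142979]),
  (18517, [142157]), (18523, [141761]), (18539, [140831, 140839]), (18541, [140741]),
  (18553, [140053]), (18617, [136519]), (18637, [135461]), (18671, [133691]), (18679, [133283]),
  (18691, [132667]), (18701, [132157, 132173]), (18713, [131023, 131063, 131071, 131111, 131143,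
  131231, 131561]), (18719, [131113, 131129, 131249]), (18743, [130057, 130073]),
  (18749, [129769]), (18757, [129379]), (18773, [128669, 128677]), (18797, [127529]),
  (18803, [127277]), (18839, [125659]), (18859, [124769, 124777]), (18899, [123031]),
  (18913, [122471]), (18917, [122273]), (18959, [120539, 120569]), (18979, [119737, 119759,
  119773]), (19001, [118897]), (19031, [117721]), (19051, [116969]), (19079, [115903, 115931]),
  (19087, [115601, 115637]), (19157, [113111]), (19181, [112289]), (19183, [112213, 112241]),
  (19211, [111271]), (19213, [111211]), (19273, [109229]), (19333, [107347]), (19373, [106123]),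
  (19403, [105251]), (19429, [104473]), (19433, [104383]), (19441, [104147]), (19447, [103969,
  103981]), (19469, [103357]), (19489, [102797]), (19507, [102293, 102299]), (19553, [101027]),
  (19577, [100391]), (19597, [99881]), (19603, [99713, 99719]), (19661, [97987, 98011, 98017,
  98041, 98047, 98101, 98143, 98179, 98221, 98227, 98251, 98257]), (19687, [97547, 97553, 97571]),
  (19697, [97367, 97373]), (19699, [97283]), (19709, [97081]), (19793, [95087, 95093]),
  (19801, [94903]), (19841, [93983]), (19889, [92921]), (19927, [92111]), (19961, [91397]),
  (19973, [91141]), (20021, [90149]), (20089, [88801]), (20161, [87421]), (20177, [87121]),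
  (20219, [86341]), (20249, [85793]), (20287, [85133]), (20297, [84947]), (20327, [84431]),
  (20333, [84317]), (20357, [83891]), (20359, [83857, 83873]), (20369, [83719]), (20389, [83357,
  83383]), (20393, [83311]), (20407, [83047]), (20411, [82981]), (20431, [82657]),
  (20441, [82499]), (20443, [82421, 82471, 82487]), (20477, [81943]), (20479, [81671, 81701, 81761,
  81901]), (20483, [81637, 81647, 81667, 81677, 81707, 81727, 81737, 81817, 81847]),
  (20507, [81401, 81421]), (20509, [81409]), (20533, [80989, 81043]), (20543, [80897]),
  (20549, [80809]), (20551, [80749, 80779]), (20593, [80107]), (20693, [78643]), (20717, [78307]),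
  (20719, [78283]), (20743, [77933]), (20749, [77849]), (20753, [77797]), (20759, [77713]),
  (20773, [77513]), (20789, [77291]), (20807, [77047]), (20857, [76369]), (20879, [76081]),
  (20897, [75833]), (20959, [75037]), (20981, [74747]), (20983, [74731]), (21013, [74353]),
  (21023, [74219]), (21059, [73783]), (21089, [73417]), (21139, [72817]), (21187, [72253]),
  (21211, [71971]), (21221, [71861]), (21377, [70123]), (21467, [69163]), (21481, [69031]),
  (21493, [68899, 68903]), (21523, [68597]), (21577, [68041]), (21589, [67931, 67939]),
  (21599, [67819]), (21649, [67339, 67343]), (21661, [67219]), (21701, [66841, 66853]),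
  (21713, [66739]), (21727, [66587])]

def weirdRows13Part3 : List (ℕ × List ℕ) := [
  (21739, [66491]), (21751, [66383]), (21773, [66179]), (21787, [65981, 65993]), (21799, [65537,
  65557, 65839, 65843, 65851, 65867]), (21803, [65537, 65557, 65581, 65839, 65843, 65851, 65867,
  65899]), (21817, [65539, 65543, 65551, 65563, 65579, 65587, 65599, 65647, 65651, 65687, 65699,
  65707, 65719]), (21821, [65539, 65543, 65551, 65563, 65579, 65587, 65599, 65647, 65651, 65687,
  65699, 65707, 65719, 65731]), (21839, [65537, 65557]), (21841, [65539, 65543, 65551]),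
  (21851, [65293, 65309, 65353, 65357, 65381, 65393, 65413, 65437, 65449]), (21859, [65309, 65353,
  65357, 65381, 65393]), (21863, [65309, 65353, 65357]), (21881, [65173]), (21893, [65063, 65071]),
  (21929, [64747]), (21937, [64693, 64709]), (21943, [64621, 64633]), (21961, [64489]),
  (22013, [64033, 64037]), (22051, [63737]), (22063, [63629]), (22067, [63599]), (22091, [63397]),
  (22093, [63377]), (22111, [63241]), (22159, [62851]), (22259, [62057]), (22271, [61967]),
  (22283, [61871]), (22291, [61813]), (22303, [61717]), (22343, [61417]), (22391, [61057]),
  (22409, [60923]), (22481, [60397]), (22483, [60383]), (22543, [59951]), (22573, [59743]),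
  (22669, [59077]), (22717, [58757]), (22721, [58727]), (22727, [58687]), (22817, [58099]),
  (22877, [57713]), (22963, [57173]), (23003, [56923]), (23021, [56813]), (23057, [56599]),
  (23117, [56237]), (23143, [56087]), (23189, [55819]), (23357, [54869]), (23369, [54799]),
  (23459, [54311]), (23537, [53897]), (23539, [53887]), (23593, [53609]), (23609, [53527]),
  (23689, [53113, 53117]), (23857, [52291]), (23879, [52189]), (23887, [52147]), (23957, [51817]),
  (24001, [51599]), (24007, [51581]), (24023, [51511]), (24043, [51419]), (24121, [51059]),
  (24169, [50839]), (24203, [50683]), (24229, [50591]), (24247, [50513]), (24281, [50363]),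
  (24379, [49937]), (24407, [49811, 49823]), (24413, [49783, 49789, 49801, 49807]),
  (24419, [49783]), (24439, [49663, 49669, 49681, 49697]), (24473, [49523, 49529, 49547]),
  (24481, [49451, 49463, 49481]), (24499, [49157, 49411, 49417, 49429]), (24509, [49171, 49177,
  49201, 49331, 49367, 49391]), (24517, [49157, 49169, 49193, 49199, 49211, 49223]),
  (24527, [49171, 49177, 49201, 49207, 49261, 49279, 49297, 49331]), (24533, [49171, 49177, 49201,
  49207, 49261, 49279, 49297]), (24547, [49157, 49169, 49193, 49199, 49211, 49223, 49253]),
  (24551, [49171, 49177, 49201, 49207]), (24571, [49157]), (24593, [48973, 48991, 49003, 49009,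
  49033, 49057, 49069]), (24611, [48973, 48991, 49003]), (24623, [48947, 48953]), (24631, [48823]),
  (24659, [48787, 48799]), (24671, [48761, 48767]), (24683, [48673, 48679]), (24691, [48677]),
  (24709, [48619]), (24733, [48497, 48527]), (24763, [48397, 48409]), (24781, [48337]),
  (24793, [48271]), (24847, [48079, 48091]), (24851, [48073, 48079]), (24859, [48049]),
  (24889, [47917]), (24919, [47809]), (24953, [47701]), (24967, [47639]), (25031, [47419]),
  (25037, [47389]), (25057, [47309]), (25073, [47269]), (25111, [47129]), (25147, [46997]),
  (25171, [46919]), (25183, [46877]), (25247, [46663]), (25309, [46447]), (25339, [46349]),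
  (25423, [46073]), (25439, [46021]), (25447, [45989]), (25541, [45691]), (25579, [45569]),
  (25583, [45557]), (25603, [45491]), (25667, [45293]), (25703, [45181]), (25799, [44887]),
  (25801, [44879]), (25867, [44683]), (25931, [44491]), (25943, [44453]), (26041, [44171]),
  (26083, [44053]), (26111, [43973]), (26119, [43951]), (26177, [43787]), (26407, [43159]),
  (26959, [41761]), (27061, [41519]), (27107, [41411]), (27281, [41011]), (27329, [40903]),
  (27449, [40637]), (27581, [40351]), (27743, [40009]), (27817, [39857]), (27953, [39581])]

def weirdRows13Part4 : List (ℕ × List ℕ) := [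
  (27983, [39521]), (28541, [38459]), (28663, [38239]), (28687, [38197]), (28979, [37691]),
  (29209, [37309]), (29231, [37273]), (29363, [37061]), (29389, [37019]), (29399, [37003]),
  (29437, [36943]), (29473, [36887]), (29483, [36871]), (29537, [36787]), (29599, [36691]),
  (29629, [36643]), (29633, [36637]), (29683, [36563]), (29741, [36473]), (29753, [36457]),
  (29803, [36383]), (29989, [36107, 36109]), (30089, [35963]), (30091, [35963]), (30119, [35923]),
  (30137, [35897]), (30161, [35863]), (30223, [35771]), (30253, [35729]), (30391, [35543]),
  (30403, [35527]), (30469, [35437]), (30491, [35407]), (30509, [35381]), (30697, [35129]),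
  (30757, [35053]), (30839, [34949]), (30859, [34919]), (30941, [34819]), (30949, [34807]),
  (30971, [34781]), (31013, [34729]), (31019, [34721]), (31051, [34679]), (31091, [34631]),
  (31159, [34543]), (31183, [34511]), (31193, [34499, 34501]), (31223, [34469]), (31231, [34457]),
  (31259, [34421]), (31277, [34403]), (31307, [34367]), (31333, [34327]), (31357, [34303]),
  (31387, [34267]), (31397, [34259]), (31567, [34057]), (31643, [33967]), (31667, [33937, 33941]),
  (31721, [33871]), (31723, [33871]), (31741, [33857]), (31769, [33827]), (31799, [33791]),
  (31817, [33773]), (31847, [33739]), (31859, [33713]), (31957, [33617]), (31973, [33599]),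
  (31991, [33577]), (32027, [33529, 33533]), (32029, [33529, 33533]), (32069, [33479, 33487,
  33493]), (32089, [33457, 33461]), (32099, [33457, 33461]), (32141, [33403, 33409, 33413]),
  (32143, [33403, 33409, 33413]), (32173, [33377]), (32189, [33347, 33349, 33353, 33359]),
  (32191, [33347, 33349, 33353, 33359]), (32203, [33349]), (32213, [33317]), (32251, [33287,
  33289]), (32257, [33287, 33289]), (32261, [33287]), (32309, [33211, 33223]), (32321, [33223]),
  (32353, [33179, 33181]), (32359, [33179, 33181]), (32363, [33179]), (32423, [33073, 33083]),
  (32429, [33083, 33091]), (32441, [33083, 33091]), (32443, [33083, 33091]), (32479, [33023, 33029,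
  33037]), (32491, [33023, 33029, 33037]), (32497, [33023, 33029, 33037]), (32503, [33023, 33029]),
  (32507, [33023, 33029]), (32531, [32933, 32939, 32941]), (32533, [32933, 32939, 32941]),
  (32537, [32933, 32939, 32941, 32957]), (32561, [32941, 32957, 32969, 32971]), (32563, [32941,
  32957, 32969, 32971]), (32569, [32957]), (32573, [32957]), (32603, [32771, 32779, 32783, 32789,
  32797, 32801]), (32609, [32771, 32779, 32783, 32789, 32797, 32801, 32803]), (32611, [32771,
  32779, 32783, 32789, 32797, 32801, 32803]), (32621, [32771, 32779, 32783, 32789, 32797, 32801,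
  32803, 32831, 32833, 32839, 32843]), (32633, [32771, 32779, 32783, 32789, 32797, 32801, 32803,
  32831, 32833, 32839, 32843, 32869]), (32647, [32771, 32779, 32783, 32789, 32797, 32801, 32803,
  32831, 32833, 32839, 32843, 32869]), (32653, [32771, 32779, 32783, 32789, 32797, 32801, 32803,
  32831, 32833, 32839, 32843, 32869]), (32687, [32771, 32779, 32783, 32789, 32797, 32801, 32803,
  32831, 32833, 32839, 32843]), (32693, [32771, 32779, 32783, 32789, 32797, 32801, 32803, 32831,
  32833, 32839]), (32707, [32771, 32779, 32783, 32789, 32797, 32801, 32803]), (32713, [32771,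
  32779, 32783, 32789, 32797, 32801, 32803]), (32717, [32771, 32779, 32783, 32789, 32797, 32801,
  32803]), (32719, [32771, 32779, 32783, 32789, 32797, 32801, 32803]), (32749, [32771, 32779,
  32783])]

def weirdRows13 : List (ℕ × List ℕ) :=
  weirdRows13Part1 ++ weirdRows13Part2 ++ weirdRows13Part3 ++ weirdRows13Part4

def weirdRows14Part1 : List (ℕ × List ℕ) := [
  (32771, [215256313, 215911733, 215952697, 216108359, 216132937, 216345949, 216411491, 216501611,
  216894863, 216919441, 217091489, 217132453, 217771487, 217877993, 217902571, 217984499,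
  218205703, 218312209, 218402329, 218754617, 218795581, 218902087, 219278953, 219541121,
  219844253, 219885217, 220262083, 220458709, 220540637, 220737263, 221114129, 221523767,
  221720393, 221851477, 221941597, 222048103, 222597017, 222924727, 222990269, 223031233,
  223227859, 223293401, 223711231, 223866893, 223907857, 224210989, 224276531, 224473157,
  224563277, 224866409, 225284239, 226177249, 226357489, 226570501, 226816283, 226947367,
  227316041, 227553631, 227643751, 227815799, 227930497, 228323749, 228495797, 228536761,
  228798929, 228889049, 228913627, 229282301, 229372421, 229700131, 229765673, 229896757,
  230109769, 230371937, 230593141, 230699647, 231076513, 231092899, 231273139, 231576271,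
  231682777, 232059643, 232321811, 232624943, 232821569, 232846147, 232911689, 233124701,
  233304941, 233517953, 233542531, 233608073, 233739157, 233845663, 233894819, 234304457,
  234394577, 234435541, 234501083, 234681323, 234722287, 234828793, 234877949, 235025419,
  235287587, 235418671, 235574333, 235598911, 235795537, 236360837, 236401801, 236450957,
  236778667, 237237461, 237581557, 237974809, 238130471, 238564687, 238654807, 239048059,
  239203721, 239351191, 239531431, 239547817, 239613359, 239793599, 240186851, 240293357,
  240530947, 240580103, 240989741, 241579619, 241694317, 242300581, 242456243, 242546363,
  243136241, 243152627, 243463951, 243635999, 244315997, 244332383, 244356961, 244512623,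
  244709249, 244750213, 244922261, 245340091, 245536717, 245839849, 245929969, 246192137,
  246298643, 246675509, 246716473, 247216231, 247281773, 247306351, 247412857, 247658639,
  247806109, 247961771, 248068277, 248158397, 248264903, 248641769, 249035021, 249182491,
  249428273, 249952609, 250321283, 250345861, 251197907, 251304413, 251328991, 251435497,
  251722243, 252287543, 252508747, 252705373, 252721759, 252877421, 252967541, 253205131,
  253311637, 253467299, 254688019, 254753561, 254843681, 255081271, 255171391, 255368017,
  255671149, 255851389, 256064401, 256416689, 256441267, 256834519, 256916447, 257006567,
  257399819, 257424397, 257793071, 257883191, 258227287, 258686081, 258776201, 258800779,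
  259079333, 259669211, 259849451, 259996921, 260349209, 260652341, 261045593, 261356917,
  261635471, 261750169, 262225349, 262356433, 262405589, 262553059, 262946311, 263101973,
  263126551, 263691851, 264306307, 264519319, 264978113, 265109197, 265158353, 265199317,
  265502449, 265682689, 265944857, 265985821, 266075941, 266141483, 266157869, 266837867,
  266968951, 267059071, 267362203, 267648949, 267927503, 268058587, 268148707, 268214249]),
  (32779, [82633127, 82674101, 82685027, 82709611, 82726001, 82829801, 82933601, 82944527,
  83089301, 83102959, 83119349, 83143933, 83223149, 83236807, 83247733, 83329681, 83430749,
  83433481, 83444407, 83471723, 83482649, 83564597, 83657471, 83692981, 83709371, 83930629,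
  84050819, 84102719, 84168277, 84310319, 84334903, 84362219, 84444167, 84455093, 84496067,
  84588941, 84610793, 84703667, 84796541, 84848441, 84859367, 85173499, 85189889, 85241789,
  85244521, 85282763, 85334663, 85359247, 85375637, 85400221, 85463047, 85479437, 85531337,
  85583237, 85646063, 85834543, 85842737, 85935611, 85938343, 86031217, 86039411, 86156869,
  86186917, 86225159, 86249743, 86290717, 86342617, 86446417, 86487391, 86555681, 86566607,
  86591191, 86659481, 86694991, 86815181, 86932639, 86949029, 87000929, 87022781, 87025513,
  87074681, 87170287, 87197603, 87353303, 87364229, 87394277, 87405203, 87533587, 87560903,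
  87604609, 87656509, 87708409, 87746651, 87801283, 88058051, 88153657, 88180973, 88246531,
  88325747, 88377647, 88429547, 88492373, 88585247, 88740947, 88885721, 88888453, 88899379,
  88951279, 88981327, 89055079, 89085127, 89096053, 89229901, 89292727, 89333701, 89434769,
  89505791]), (32783, [63244553, 63265043, 63340853, 63344951, 63449447, 63541649, 63558041,
  63562139, 63662537, 63738347, 63754739, 63769081, 63777277, 63793669, 63830549, 63834647,
  63865381, 63869479, 63943241, 64055933, 64144037, 64152233, 64236239, 64271071, 64348931,
  64375567, 64424741, 64428839, 64432937, 64459573, 64463671, 64568167, 64625537, 64646027,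
  64676761, 64738229, 64777159, 64830431, 64852969, 64922633, 64945171, 64953367, 64965661,
  65027129, 65145967, 65154163, 65162359, 65211533, 65242267, 65254561, 65311931, 65316029,
  65328323, 65354959, 65404133, 65559853, 65635663, 65660251, 65717621, 65725817, 65740159,
  65760649, 65813921, 65822117, 65840557, 65852851, 65897927, 65918417, 66033157, 66049549,
  66098723, 66106919, 66129457, 66149947, 66233953, 66303617, 66315911, 66322057, 66387623,
  66408113, 66416309, 66434749, 66438847, 66608909, 66623251, 66684719, 66701111, 66705209,
  66719551, 66727747, 66740041, 66781019, 66893711, 66912151, 67006403, 67012549, 67016647,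
  67086311, 67094507, 67102703, 67121143]), (32789, [46740719, 46742209, 46777979, 46819711,
  46901683, 46915097, 46952357, 46994089, 47008993, 47011973, 47038801, 47076061, 47082023,
  47098417, 47135677, 47141639, 47178899, 47286209, 47287699, 47293661, 47395009, 47432269,
  47468039, 47514241, 47535107, 47542559, 47550011, 47587271, 47621551, 47643907, 47702033,
  47716937, 47769101, 47795929, 47803381, 47825737, 47840641, 47848093, 47861507, 47885353,
  47907709, 47980739, 47988191, 48089539, 48117857, 48174493, 48189397, 48192377, 48196849,
  48204301, 48241561, 48262427, 48271369, 48301177, 48344399, 48359303, 48378679, 48389111,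
  48408487, 48453199, 48459161, 48460651, 48468103, 48483007, 48490459, 48520267, 48526229,
  48648443, 48663347, 48678251, 48687193, 48702097, 48717001, 48772147]), (32797, [34680641,
  34693759, 34707971, 34714531, 34723277, 34750607, 34762633, 34768099, 34782311, 34824947,
  34826041, 34856651, 34862117, 34867583, 34868677, 34874143, 34899287, 34920059, 34930991,
  34941923, 34943017, 34948483, 34957229, 34968161, 34979093, 34985653, 35010797, 35012983,
  35021729, 35028289, 35044687, 35116841, 35124493, 35127773, 35159477, 35161663, 35170409,
  35230537, 35244749, 35340953, 35372657, 35384683, 35430599, 35446997, 35459023, 35467769,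
  35475421, 35489633, 35501659, 35518057, 35538829, 35558507, 35569439, 35586931, 35629567,
  35640499, 35643779, 35735611, 35749823, 35752009]), (32801, [30711383, 30727783, 30746113,
  30748043, 30764443, 30824257, 30842587, 30856093, 30892753, 30897577, 30924589, 30970897,
  30979579, 30984403, 30989227, 30990191, 30997909, 31002733, 31008521, 31045181, 31052899,
  31094383, 31100171, 31112713, 31149373, 31205327, 31236199, 31299871, 31315307, 31318201,
  31346179, 31347143, 31356791, 31365473, 31375121, 31382839, 31420463, 31425287, 31437829,
  31460017, 31475453, 31485101, 31493783, 31496677, 31512113, 31515007, 31538161, 31574821,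
  31598939, 31606657, 31608587]), (32803, [29072569, 29081681, 29088971, 29095349, 29102639,
  29133619, 29143643, 29181913, 29203781, 29209249, 29222917, 29235673, 29330437, 29331349,
  29337727, 29339549, 29346839, 29353217, 29448893, 29475317, 29476229, 29577371, 29581927,
  29584661, 29597417, 29598329, 29601973, 29609263, 29611997, 29616553, 29658467, 29677603,
  29690359, 29711317, 29758699, 29767811, 29772367, 29799703, 29819749]), (32831, [16550927,
  16555031, 16557083, 16558109, 16561187, 16572473, 16578629, 16580167, 16591453, 16592479,
  16594531, 16605817, 16607869, 16609921, 16645829, 16647881, 16649933, 16663271, 16668401,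
  16669427, 16674557, 16680199, 16682251, 16687381, 16690459, 16695589, 16702771, 16748939,
  16750991, 16753043, 16758173, 16759199, 16763303, 16767407, 16777153, 16785361, 16790491,
  16791517]), (32833, [16062799, 16067773, 16068271, 16075733, 16084687, 16107571, 16131449,
  16142891, 16152841, 16171247, 16175227, 16180699, 16182191, 16182689, 16204577, 16210547,
  16216019, 16225969, 16227461, 16231441, 16233431, 16238903, 16249847, 16259797, 16260791,
  16264771, 16265269, 16276213, 16287157, 16295117]), (32839, [14745167, 14745623, 14747903,
  14756113, 14757481, 14776637, 14784391, 14786671, 14804003, 14812669, 14830457, 14830913,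
  14832281, 14833649, 14839579, 14842771, 14858279, 14860103, 14869681, 14870593, 14916659,
  14943113, 14944481]), (32843, [13988957, 13989389, 13990253, 13995439, 13995871, 14007971,
  14013157, 14025689, 14031739, 14042111, 14043839, 14048161, 14049457, 14060693, 14061557,
  14062421, 14065879, 14077979, 14078843, 14080571, 14084029, 14086621, 14103043, 14103907,
  14120329, 14122057, 14132429, 14138479, 14139343, 14151443]), (32869, [10457497, 10469743,
  10470709, 10472321, 10480699, 10481021, 10488433, 10506479, 10509701, 10511957, 10522913,
  10530647, 10532581, 10532903, 10535803, 10540637, 10541603, 10546759]), (32887, [8906347,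
  8907169, 8907443, 8913199, 8913473, 8916487, 8922791, 8923339, 8923613, 8926079, 8931287,
  8934301, 8935397, 8959789, 8961707, 8962529, 8963351, 8972669, 8978699]), (32909, [7543577,
  7547053, 7548907, 7556323, 7563971, 7567447, 7569533, 7569997, 7571387, 7573009, 7575559,
  7576949, 7578803, 7582511, 7584133, 7586219, 7588073, 7590623, 7592477]), (32911, [7440857,
  7441771, 7441999, 7449313, 7458683, 7471939, 7473311, 7476739, 7478567, 7480853]),
  (32917, [7145183, 7146719, 7147597, 7151327, 7153961, 7154839, 7160983, 7166689, 7170419,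
  7174369, 7174589, 7177661, 7181611, 7181831, 7187317]), (32933, [6462803, 6465581, 6465779,
  6466771, 6466969, 6472723, 6475103, 6475897, 6477683, 6483833, 6484031, 6489983, 6499307,
  6500101]), (32939, [6240791, 6244621, 6245387, 6249409, 6253813, 6254579, 6254771, 6258793,
  6259367, 6263963, 6266453, 6268751, 6270857, 6271049, 6274687]), (32941, [6169811, 6170947,
  6176437, 6179087, 6180413, 6185713, 6187039, 6187607, 6198019, 6198587, 6202373]),
  (32957, [5655941, 5657329, 5659063, 5659237, 5659931, 5660971, 5661839, 5673287]),
  (32969, [5322371, 5323187, 5331511, 5333959, 5335591, 5340161, 5343589, 5346037, 5347669]),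
  (32971, [5271157, 5271319, 5271481, 5273743, 5274067, 5274551, 5274713, 5276329, 5281663,
  5282633, 5284087, 5285057, 5290067, 5292653, 5295239]), (32983, [4981349, 4981807, 4987457,
  4988831, 4996619, 4997687, 5000741]), (32987, [4898119, 4898269, 4899019, 4899619, 4902467,
  4902767, 4902917, 4913113]), (32993, [4751137, 4774349, 4775371, 4775809, 4776539, 4776977,
  4778437, 4778729, 4781941, 4782671, 4783109]), (32999, [4648307, 4648591, 4649303, 4649587,
  4651721, 4655419, 4655561, 4656983]), (33013, [4381469, 4384153, 4385629, 4385897, 4386971,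
  4388179, 4389521, 4391131, 4391399, 4392473, 4396633]), (33023, [4210819, 4211593, 4212367,
  4212883, 4213141, 4214173, 4215979, 4216237, 4216753, 4217011, 4219333, 4219849, 4221913,
  4223977, 4225783]), (33029, [4117279, 4117657, 4117783, 4117909, 4118161, 4118287, 4125347,
  4125851, 4126481, 4126607, 4128877, 4129003, 4129129, 4129381, 4129507, 4129633, 4130389]),
  (33037, [3995029, 3996131, 3998333, 3999067, 4000291, 4001147, 4002983, 4003717, 4005307,
  4007021, 4007999]), (33049, [3826769, 3827003, 3831691, 3835441, 3836731, 3837199, 3839309]),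
  (33053, [3777749, 3779021, 3780061, 3780407, 3782257, 3783181, 3785261, 3786533]),
  (33071, [3555241, 3556981, 3558613, 3560027, 3560789, 3561659, 3562529, 3563291]),
  (33073, [3530921, 3531569, 3531677, 3533731, 3533839, 3534379, 3538919, 3539027]),
  (33083, [3423881, 3424613, 3427859, 3428801]), (33091, [3338003, 3339229, 3339331, 3342293]),
  (33107, [3181777, 3182653, 3183043, 3185867, 3186061, 3186451, 3190151]), (33113, [3128891,
  3128987, 3130901, 3134633, 3135877]), (33119, [3076397, 3076679, 3078373, 3078749, 3080443,
  3081007, 3082231, 3082889]), (33149, [2837363, 2839099, 2842223, 2842309, 2843177]),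
  (33151, [2822669, 2823101, 2823791, 2825777, 2825863, 2826727, 2826899, 2828281, 2828453]),
  (33161, [2751689, 2752447, 2752531, 2754467, 2754551, 2754803, 2755813]), (33179, [2632657,
  2634509, 2636119]), (33181, [2620417, 2620577, 2621459, 2621699, 2621779, 2622821, 2623783,
  2625947, 2626027]), (33191, [2555863, 2559229, 2560247, 2561969, 2562517]), (33199, [2514977,
  2517283, 2517821]), (33203, [2490377, 2490529, 2491519, 2492509, 2493347, 2494489]),
  (33211, [2445571, 2446319, 2446693, 2448937, 2450807]), (33223, [2382511, 2382803, 2383313,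
  2384843, 2385571, 2385863, 2386591, 2386883]), (33247, [2266129, 2266267, 2266337, 2267029,
  2267653, 2267791]), (33287, [2097401]), (33289, [2085983, 2086493, 2086939, 2088661]),
  (33301, [2040029, 2040403, 2041027, 2042149]), (33311, [2002823, 2003191, 2003497, 2003681,
  2003803, 2004109, 2004293, 2005579, 2005763]), (33317, [1981513, 1983997, 1984057]),
  (33329, [1939901, 1939961, 1941503, 1941799]), (33331, [1935443]), (33343, [1895051, 1895167,
  1896151]), (33347, [1881403, 1881863]), (33349, [1867429, 1867601, 1874993, 1875451, 1876081,
  1876597, 1877399]), (33353, [1862417, 1863157, 1863271, 1863613, 1864979]), (33359, [1843591,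
  1844099]), (33377, [1790539, 1791961, 1792673]), (33391, [1750673, 1751047, 1751689, 1752599]),
  (33403, [1718573, 1720307, 1720517, 1720937]), (33409, [1703963, 1704067, 1704119, 1704431,
  1704587, 1704847]), (33413, [1692683, 1692839, 1693201, 1693511, 1694701]), (33427, [1658029,
  1658941]), (33457, [1587413, 1588043, 1588189, 1588577, 1588819]), (33461, [1577729, 1579031,
  1579561, 1579609]), (33469, [1560217, 1560313, 1561123, 1561457]), (33479, [1539281, 1539563]),
  (33487, [1521937, 1522681, 1523891]), (33493, [1507369, 1509953, 1510921, 1510967, 1511429]),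
  (33503, [1474177, 1489973, 1490701, 1491247]), (33521, [1455007, 1455673]), (33533, [1432813,
  1433119, 1433207, 1433251, 1433513]), (33547, [1408027, 1409017]), (33563, [1380341, 1380721,
  1380763, 1380889, 1380931]), (33569, [1369883, 1371389, 1371431]), (33577, [1357091, 1357547,
  1358251]), (33581, [1351037, 1351243, 1351697]), (33587, [1340653, 1340981, 1341677, 1341841,
  1342087]), (33589, [1337389, 1338247]), (33599, [1321951, 1322597, 1323001, 1323041]),
  (33601, [1318859]), (33613, [1300457, 1301887]), (33617, [1294649, 1294729, 1295243, 1295717]),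
  (33619, [1291963, 1292713]), (33623, [1277791, 1286119, 1286629, 1286983, 1287061]),
  (33629, [1278097, 1278253]), (33637, [1265911, 1266259, 1266413, 1266491, 1266761]),
  (33641, [1260113, 1260767]), (33647, [1245091, 1252777]), (33679, [1209083, 1209563]),
  (33703, [1179641, 1179677]), (33713, [1166947, 1167731]), (33721, [1158037]), (33739, [1113421,
  1137163, 1137233, 1137337]), (33749, [1113751, 1125127, 1125401, 1125539]), (33751, [1122941,
  1123181, 1123729, 1123867, 1123901]), (33757, [1114049, 1114117]), (33773, [1099771, 1100039]),
  (33791, [1080553, 1080817, 1081279]), (33797, [1075007, 1075171]), (33811, [1060253, 1060739]),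
  (33827, [1044839, 1045573]), (33829, [1042837, 1042901, 1042997, 1043761]), (33851, [1022837,
  1022899]), (33857, [1015523, 1016051, 1016921, 1017449]), (33863, [1011749, 1012213]),
  (33871, [1004747, 1005269]), (33889, [982841, 982871, 989123]), (33893, [985937, 985997, 986147,
  986177]), (33911, [970583, 970643, 970909, 970939, 970969]), (33923, [961141]),
  (33931, [954469]), (33937, [949771, 950177]), (33967, [927497]), (33997, [905011, 905453]),
  (34019, [889901]), (34039, [876263, 876611]), (34057, [864757]), (34061, [851603, 862159, 862343,
  862369, 862501]), (34123, [824437, 824513, 824563]), (34127, [818897, 818947, 819073, 819173,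
  821833]), (34129, [819271, 820649]), (34157, [804901, 805073, 805097]), (34159, [803669,
  803963]), (34171, [797201]), (34183, [786329, 790481, 790747, 790819, 790843]), (34213, [774997,
  775163]), (34217, [772903, 773021, 773209]), (34253, [753427, 753589, 753773, 754003, 755087]),
  (34259, [752251]), (34261, [751357, 751379]), (34273, [745471, 745517, 745631, 745699]),
  (34283, [740951]), (34297, [734381, 734471]), (34301, [732239, 732283, 732373]), (34313, [726809,
  727009]), (34319, [724259, 724303]), (34337, [716549]), (34351, [710441, 710527]),
  (34361, [706297]), (34367, [703471]), (34369, [702869]), (34381, [697759, 697951, 697993]),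
  (34403, [688249, 688333, 688543, 688627, 688669]), (34421, [681677, 681781])]

def weirdRows14Part2 : List (ℕ × List ℕ) := [
  (34429, [678533, 678553, 678719]), (34439, [674711]), (34469, [663437, 663599]), (34483, [655337,
  655357, 658211]), (34487, [655273, 655373, 655453, 656917, 656977]), (34499, [652373, 652453,
  652493]), (34501, [651857, 651877]), (34519, [645497]), (34543, [636983, 637003, 637139]),
  (34583, [622513]), (34589, [621937, 622051]), (34591, [621007, 621139]), (34603, [617369]),
  (34607, [616079, 616117, 616211]), (34613, [614183, 614333]), (34649, [603209, 603227]),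
  (34651, [602401, 602603]), (34667, [597659, 597677, 597823, 597859]), (34679, [594313]),
  (34687, [589751, 589859, 589877, 591901, 591937, 591973]), (34693, [589997, 590033, 590123,
  590141]), (34721, [582083]), (34729, [579737, 579949, 579967]), (34739, [577033, 577069]),
  (34747, [574799, 574817, 575027]), (34757, [572093]), (34759, [571673]), (34763, [570419]),
  (34781, [565769, 565787]), (34819, [555967]), (34843, [549733, 549767, 549817]),
  (34847, [548957]), (34849, [548227, 548461]), (34871, [542837, 543019]), (34877, [541469]),
  (34897, [536791]), (34913, [532919, 532951, 533033]), (34919, [531589]), (34939, [524261]),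
  (34949, [524347, 524411, 524507, 524683, 524731, 524827]), (34961, [521929]), (34963, [521483]),
  (34981, [517589]), (35051, [502699]), (35053, [502441]), (35059, [501013, 501043, 501089]),
  (35083, [496297]), (35099, [491581, 491611, 493177]), (35141, [484987]), (35149, [483409]),
  (35153, [482683]), (35171, [479299, 479387]), (35201, [473723, 473839]), (35221, [470201]),
  (35257, [463849, 463891, 463919]), (35267, [462181]), (35279, [458879, 458921, 460073, 460087,
  460157, 460171]), (35281, [458807, 458849, 458863, 458891, 458947, 459031, 459649, 459677,
  459691, 459803, 459817]), (35291, [458027, 458069]), (35323, [452689, 452731, 452759]),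
  (35327, [452033, 452171]), (35339, [450077]), (35353, [447859]), (35363, [446273]),
  (35381, [443453, 443467]), (35393, [441563]), (35401, [440281]), (35423, [436999]),
  (35437, [434813, 434839]), (35449, [432961, 433093]), (35461, [431257, 431297]),
  (35491, [426061]), (35507, [424451]), (35509, [424243]), (35521, [422537, 422563, 422627]),
  (35527, [421741]), (35533, [420859]), (35543, [419473, 419537]), (35569, [415949]),
  (35593, [412619]), (35597, [412157]), (35617, [409433, 409483]), (35671, [402379]),
  (35677, [401629]), (35729, [393187, 395093, 395141]), (35731, [393161, 393209, 393257, 394897,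
  394969, 394981, 394993]), (35747, [392569, 392593, 392629, 392737, 392761, 392809, 392857,
  392893, 392929, 393013]), (35831, [383101, 383113, 383171]), (35837, [382463]), (35839, [382189,
  382271]), (35869, [378809, 378821]), (35923, [372877]), (35933, [371837]), (35963, [368609]),
  (35969, [368047]), (35977, [367189]), (35983, [366599]), (35999, [364879]), (36013, [363491]),
  (36037, [360821]), (36067, [358079]), (36097, [355127]), (36109, [354023]), (36131, [351847]),
  (36137, [351311, 351343]), (36191, [346277]), (36241, [341827]), (36251, [340909, 340919]),
  (36263, [339799, 339841]), (36341, [333139]), (36343, [332951]), (36353, [332113]),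
  (36373, [330433]), (36383, [329519]), (36433, [325571, 325631]), (36467, [322939]),
  (36469, [322783]), (36479, [322001]), (36527, [318299, 318319]), (36551, [316469]),
  (36559, [315851, 315899]), (36599, [312887]), (36607, [312313]), (36629, [310711]),
  (36643, [309707]), (36653, [309013]), (36691, [306347]), (36713, [304831]), (36721, [304253]),
  (36739, [303013]), (36749, [302399]), (36779, [300319]), (36791, [299521, 299539]),
  (36809, [298369]), (36821, [297601]), (36833, [296801, 296819]), (36847, [294893, 294911, 294947,
  295037, 295787, 295877]), (36857, [294919, 294991, 295081, 295153]), (36877, [293957]),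
  (36887, [293269]), (36913, [291689]), (36919, [291359]), (36923, [291101]), (36929, [290711]),
  (36997, [286547, 286591]), (37013, [285599]), (37019, [285251]), (37061, [282773]),
  (37087, [281251]), (37097, [280703, 280729])]

def weirdRows14Part3 : List (ℕ × List ℕ) := [
  (37139, [278321, 278347]), (37201, [274871]), (37223, [273709]), (37273, [271027]),
  (37277, [270791, 270799]), (37307, [269251]), (37321, [268507]), (37339, [267587]),
  (37357, [266683]), (37361, [266447, 266479]), (37363, [266353, 266369]), (37379, [265543,
  265567]), (37397, [264581]), (37409, [263909]), (37423, [262153]), (37441, [262103, 262111,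
  262127, 262151, 262231, 262271, 262303, 262351, 262391, 262399]), (37447, [262153]),
  (37463, [261323, 261347, 261379]), (37483, [260417]), (37517, [258733]), (37561, [256721]),
  (37567, [256441]), (37589, [255413]), (37591, [255313]), (37607, [254593]), (37619, [254021]),
  (37691, [250793]), (37717, [249671]), (37747, [248357]), (37783, [246787, 246809, 246817]),
  (37799, [246121]), (37811, [245591, 245621, 245629]), (37853, [243863, 243871]), (37861, [243517,
  243539]), (37871, [243119]), (37879, [242797]), (37889, [242357]), (37951, [239843, 239851,
  239873]), (37957, [239611, 239633, 239641]), (37963, [239387]), (37967, [239243]),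
  (37987, [238423]), (37993, [238201]), (37997, [238037]), (38039, [236387]), (38047, [236107]),
  (38119, [233357]), (38153, [232091]), (38183, [231001]), (38189, [230761]), (38201, [229409,
  229423, 230239, 230281, 230309]), (38219, [229433, 229601, 229699]), (38231, [228959, 229127,
  229253, 229267]), (38237, [228911, 228953, 229037]), (38239, [228923]), (38261, [228131]),
  (38273, [227719]), (38281, [227471]), (38299, [226789, 226817, 226823]), (38303, [226649,
  226697]), (38317, [226201]), (38351, [225023, 225037]), (38371, [224351]), (38377, [224153]),
  (38449, [221707]), (38453, [221567, 221581]), (38569, [217793]), (38593, [217057]),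
  (38629, [215899]), (38639, [215587]), (38671, [214603]), (38693, [213947]), (38699, [213751]),
  (38729, [212827]), (38767, [211693]), (38783, [211217]), (38821, [210097]), (38861, [208927,
  208933]), (38903, [207721]), (38917, [207329]), (38977, [205661]), (38993, [205211]),
  (39019, [204481, 204487]), (39023, [204371, 204377]), (39041, [203873]), (39043, [203843]),
  (39113, [201937]), (39139, [201247]), (39157, [200779]), (39163, [200609]), (39191, [199877,
  199889]), (39199, [199657, 199669]), (39209, [199429]), (39229, [198901]), (39233, [198761]),
  (39239, [198589]), (39241, [198593, 198599]), (39251, [198337, 198349]), (39293, [196657, 196663,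
  196681, 196687, 196699, 196717]), (39301, [196583, 196613, 196643, 196661, 196709, 196727,
  196739, 196751, 196769, 196799, 196817, 196853, 196871, 196901, 196907]), (39313, [196583,
  196613, 196643, 196661, 196709, 196727, 196739, 196751, 196769]), (39317, [196657, 196663,
  196681, 196687]), (39323, [196159, 196171, 196177, 196201, 196279, 196291, 196303, 196387,
  196429, 196453, 196459, 196477, 196501, 196519]), (39343, [195907, 195913, 195919, 195931,
  195967, 195973, 195991, 195997, 196003]), (39359, [195541]), (39367, [195427]),
  (39371, [195281]), (39419, [194167]), (39503, [192149]), (39509, [192007, 192013]),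
  (39541, [191249]), (39551, [191021, 191027]), (39563, [190753]), (39623, [189353]),
  (39703, [187547]), (39779, [185869]), (39821, [184969]), (39863, [184057]), (39883, [183637]),
  (39953, [182179]), (39971, [181789]), (40031, [180563, 180569]), (40129, [178601]),
  (40153, [178117, 178127]), (40213, [176951]), (40253, [176191]), (40277, [175727]),
  (40289, [175499]), (40343, [174487]), (40357, [174221]), (40387, [173669]), (40427, [172933]),
  (40471, [172127]), (40499, [171617]), (40507, [171469]), (40529, [171091]), (40543, [170827,
  170837]), (40577, [170231]), (40627, [169361]), (40637, [169177]), (40699, [168127]),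
  (40739, [167437]), (40763, [167033]), (40771, [166909]), (40787, [166631]), (40801, [166393,
  166403]), (40813, [166183]), (40819, [166099]), (40823, [166043]), (40847, [165617])]

def weirdRows14Part4 : List (ℕ × List ℕ) := [
  (40849, [165589]), (40853, [165523, 165533]), (40879, [165037, 165047, 165103]),
  (40883, [164987]), (40897, [164729]), (40903, [164677, 164707]), (40927, [163853, 163883, 163973,
  163993, 164023, 164209, 164239, 164249, 164279, 164299, 164309]), (40933, [163847, 163927,
  163987, 163997, 164057, 164117, 164233]), (40939, [163841, 163861, 163871, 163901, 163981,
  163991, 164011, 164051, 164071]), (40949, [163841, 163861, 163871, 163901, 163981, 163991]),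
  (40961, [163469, 163679, 163729, 163789]), (40973, [163477, 163487, 163517, 163567]),
  (40993, [163199, 163249, 163259]), (41011, [162989]), (41017, [162889]), (41039, [162553,
  162563]), (41047, [162413]), (41077, [161969]), (41081, [161873]), (41113, [161407]),
  (41117, [161341]), (41177, [160409, 160423]), (41179, [160403]), (41183, [160313]),
  (41221, [159769]), (41233, [159589]), (41269, [159023]), (41341, [157991]), (41491, [155833]),
  (41597, [154351]), (41611, [154159]), (41617, [154081]), (41627, [153949]), (41851, [150961]),
  (41927, [149971]), (41959, [149563]), (41969, [149441]), (41999, [149057]), (42071, [148157]),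
  (42083, [148013]), (42179, [146833, 146837]), (42293, [145477]), (42307, [145307]),
  (42359, [144701]), (42397, [144259]), (42407, [144139]), (42443, [143729]), (42451, [143629]),
  (42457, [143569]), (42461, [143519]), (42491, [143177]), (42509, [142969, 142973]),
  (42557, [142433]), (42677, [141101]), (42697, [140891]), (42701, [140839]), (42727, [140557]),
  (42737, [140449, 140453]), (42797, [139813]), (42839, [139367]), (42863, [139109]),
  (42899, [138727, 138731]), (43003, [137659]), (43019, [137491]), (43037, [137303]),
  (43067, [136999]), (43133, [136343]), (43159, [136067]), (43189, [135787]), (43201, [135647]),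
  (43207, [135601]), (43261, [135059]), (43319, [134513]), (43399, [133723]), (43481, [132967,
  132971]), (43517, [132611, 132619, 132623, 132631]), (43541, [132409, 132421]),
  (43579, [132071]), (43597, [131837, 131849, 131861]), (43607, [131701]), (43609, [131687, 131707,
  131711]), (43613, [131707, 131711, 131731, 131743, 131759]), (43627, [131101, 131113, 131507,
  131519, 131543]), (43633, [131063, 131071, 131111, 131143, 131501, 131561]), (43649, [131063,
  131071, 131111, 131143, 131171, 131203, 131231, 131251, 131267, 131303]), (43651, [131101,
  131113, 131129, 131149, 131213, 131221, 131249, 131293, 131297, 131317, 131321]),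
  (43661, [131063, 131071, 131111, 131143, 131171, 131203, 131231, 131251, 131267, 131303,
  131311]), (43669, [131063, 131071, 131111, 131143, 131171, 131203, 131231, 131251]),
  (43691, [130729, 130769, 130817, 130829, 130841, 130873, 130957, 130969, 130973, 130981, 131009,
  131041]), (43711, [130769, 130817, 130829, 130841, 130873]), (43717, [130783, 130787, 130807,
  130811]), (43721, [130783]), (43759, [130369, 130409]), (43777, [130241, 130253, 130261]),
  (43787, [130121]), (43789, [130127, 130147, 130171]), (43793, [130127]), (43801, [130057, 130069,
  130073]), (43853, [129581, 129589, 129593]), (43867, [129443]), (43889, [129287]),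
  (43891, [129281]), (43913, [129083]), (43933, [128903]), (43943, [128813]), (43963, [128657]),
  (44017, [128189]), (44021, [128159]), (44029, [128099]), (44041, [127997]), (44053, [127873,
  127877]), (44059, [127849]), (44071, [127733]), (44089, [127597]), (44101, [127493]),
  (44119, [127343]), (44131, [127247]), (44203, [126641]), (44257, [126211]), (44263, [126151]),
  (44281, [126001]), (44351, [125453]), (44383, [125197]), (44543, [123941]), (44563, [123787]),
  (44647, [123143]), (44651, [123113]), (44683, [122867]), (44687, [122833]), (44819, [121853]),
  (44909, [121189]), (45053, [120157]), (45077, [119983]), (45137, [119563]), (45139, [119549]),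
  (45233, [118891]), (45307, [118387]), (45377, [117911]), (45427, [117571]), (45497, [117109]),
  (45523, [116933]), (45533, [116867]), (45677, [115933]), (45751, [115459]), (45757, [115421]),
  (45949, [114217]), (45971, [114077]), (46051, [113591]), (46147, [113011]), (46451, [111229])]

def weirdRows14Part5 : List (ℕ × List ℕ) := [
  (46457, [111191]), (46499, [110951]), (46507, [110909]), (46567, [110569]), (46591, [110431]),
  (46679, [109943]), (46691, [109873]), (46703, [109807]), (46747, [109567]), (46819, [109171]),
  (46861, [108943]), (46901, [108727]), (46919, [108631]), (47017, [108109]), (47087, [107741]),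
  (47143, [107449]), (47237, [106963]), (47293, [106681]), (47297, [106657]), (47303, [106627]),
  (47353, [106373]), (47491, [105683]), (47507, [105607]), (47527, [105509]), (47609, [105097,
  105107]), (47713, [104597]), (47777, [104297]), (47779, [104281]), (47791, [104231]),
  (47837, [104009]), (47843, [103981]), (47903, [103699]), (47933, [103561]), (47951, [103471]),
  (47969, [103387, 103391]), (47977, [103357]), (48023, [103141]), (48073, [102911]),
  (48079, [102877]), (48119, [102701]), (48239, [102161]), (48259, [102059]), (48311, [101837]),
  (48353, [101641]), (48413, [101377, 101383]), (48437, [101281]), (48463, [101149]),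
  (48487, [101051, 101063]), (48523, [100907]), (48539, [100829]), (48541, [100823]),
  (48571, [100703]), (48593, [100609]), (48611, [100523]), (48623, [100459]), (48647, [100363]),
  (48661, [100291, 100297]), (48751, [99923, 99929]), (48757, [99901, 99907]), (48761, [99881]),
  (48767, [99859, 99871]), (48779, [99787, 99809]), (48787, [99787]), (48799, [99719]),
  (48809, [99689]), (48821, [99643]), (48857, [99487]), (48859, [99469]), (48869, [99431]),
  (48871, [99401]), (48883, [99367]), (48907, [99277, 99289]), (48947, [99079, 99119]),
  (48953, [99079]), (48989, [98929, 98947, 98953]), (48991, [98869, 98887, 98893, 98899, 98939]),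
  (49003, [98887, 98893]), (49019, [98731, 98737, 98773, 98779]), (49031, [98737, 98773, 98779]),
  (49033, [98689]), (49057, [98321, 98327, 98369]), (49069, [98321, 98327, 98369, 98387, 98411,
  98429]), (49081, [98321, 98327, 98369, 98387, 98411, 98429, 98453, 98459, 98507]),
  (49103, [98317, 98323, 98347, 98377, 98389, 98407, 98419, 98443, 98467, 98473, 98479, 98491]),
  (49109, [98317, 98323, 98347, 98377, 98389, 98407, 98419, 98443, 98467]), (49117, [98321, 98327,
  98369, 98387, 98411, 98429]), (49121, [98317, 98323, 98347, 98377, 98389, 98407, 98419]),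
  (49123, [98321, 98327, 98369, 98387, 98411]), (49139, [98317, 98323, 98347]), (49157, [98011,
  98017, 98041, 98047, 98101, 98143, 98179, 98221, 98227, 98251, 98257, 98269]), (49169, [98011,
  98017, 98041, 98047, 98101, 98143, 98179, 98221, 98227]), (49171, [98009, 98057, 98081, 98123,
  98129, 98207, 98213]), (49177, [98057, 98081, 98123, 98129]), (49193, [98041, 98047, 98101]),
  (49199, [98041, 98047, 98101]), (49201, [98057, 98081]), (49207, [98057]), (49211, [97919, 97931,
  97943, 97961, 97967, 97973, 98009, 98047]), (49223, [97931, 97943, 97961, 97967, 97973, 98009]),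
  (49253, [97771, 97777]), (49261, [97787, 97829, 97841, 97847, 97861]), (49297, [97687, 97711]),
  (49307, [97651]), (49331, [97583]), (49333, [97549, 97561, 97579]), (49339, [97499, 97549]),
  (49363, [97423, 97429, 97441]), (49369, [97373, 97379, 97423, 97429]), (49393, [97327]),
  (49409, [97259, 97283]), (49417, [97231]), (49433, [97169, 97187]), (49451, [97117]),
  (49477, [96979]), (49523, [96823]), (49529, [96821]), (49537, [96787]), (49547, [96749]),
  (49559, [96703]), (49597, [96527, 96553]), (49613, [96487]), (49627, [96431]), (49639, [96377]),
  (49667, [96289]), (49697, [96179]), (49747, [95987]), (49807, [95773]), (49823, [95717]),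
  (49853, [95603]), (49891, [95461, 95467]), (49993, [95087]), (49999, [95071]), (50033, [94951]),
  (50053, [94873]), (50069, [94819]), (50077, [94793]), (50101, [94693]), (50131, [94597]),
  (50147, [94543]), (50207, [94331]), (50287, [94049]), (50291, [94033]), (50333, [93889]),
  (50753, [92459]), (50821, [92237]), (50867, [92083]), (50909, [91943]), (50969, [91753]),
  (50993, [91673]), (51047, [91499])]

def weirdRows14Part6 : List (ℕ × List ℕ) := [
  (51059, [91463]), (51061, [91457]), (51109, [91303]), (51349, [90547]), (51383, [90439]),
  (51487, [90121]), (51503, [90067]), (51521, [90017]), (51659, [89599]), (51683, [89527]),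
  (51721, [89413]), (51749, [89329]), (51829, [89087]), (51853, [89021]), (51859, [89003]),
  (51869, [88969]), (51929, [88793]), (52027, [88513]), (52067, [88397]), (52313, [87697]),
  (52363, [87557]), (52567, [86993]), (52631, [86813]), (52757, [86477]), (52807, [86341]),
  (52837, [86263]), (52973, [85903]), (53239, [85213]), (53623, [84247]), (53657, [84163]),
  (53719, [84011]), (53897, [83579]), (53959, [83431]), (54091, [83117]), (54503, [82163]),
  (54917, [81239]), (55021, [81013]), (55399, [80207]), (55807, [79367]), (56123, [78737]),
  (56131, [78721]), (56239, [78509]), (56249, [78487]), (56359, [78277]), (56401, [78193]),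
  (56773, [77489]), (56813, [77417]), (56843, [77359]), (56893, [77269]), (56963, [77141]),
  (56989, [77093]), (57163, [76777]), (57283, [76561]), (57427, [76303]), (57457, [76253]),
  (57601, [76001]), (57641, [75931]), (57773, [75703]), (57787, [75679]), (57847, [75577]),
  (57947, [75407]), (58027, [75269]), (58367, [74707]), (58379, [74687]), (58427, [74609]),
  (58453, [74567]), (58481, [74521]), (58549, [74411]), (58579, [74363]), (58631, [74279]),
  (58661, [74231]), (58687, [74189]), (58693, [74177]), (58789, [74027]), (58921, [73819]),
  (58991, [73709]), (59009, [73681]), (59051, [73613]), (59063, [73597]), (59107, [73529]),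
  (59113, [73517]), (59209, [73369]), (59369, [73127]), (59393, [73091]), (59443, [73013]),
  (59447, [73009]), (59471, [72973]), (59539, [72871]), (59611, [72763]), (59791, [72497]),
  (59921, [72307]), (60013, [72173]), (60017, [72167]), (60037, [72139]), (60139, [71987]),
  (60167, [71947]), (60209, [71887]), (60223, [71867]), (60257, [71821]), (60259, [71821]),
  (60331, [71719]), (60343, [71699]), (60497, [71483]), (60601, [71341]), (60611, [71327]),
  (60659, [71261]), (60679, [71233]), (60727, [71167]), (60737, [71153]), (60913, [70913]),
  (61057, [70717]), (61099, [70663]), (61141, [70607]), (61231, [70487]), (61357, [70321]),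
  (61363, [70313]), (61381, [70289]), (61493, [70141]), (61511, [70117]), (61657, [69931]),
  (61717, [69847]), (61843, [69691]), (61871, [69653]), (61949, [69557]), (62003, [69491]),
  (62011, [69481]), (62017, [69473]), (62039, [69439]), (62081, [69389]), (62099, [69371]),
  (62189, [69259]), (62459, [68927]), (62467, [68917]), (62477, [68903]), (62483, [68891]),
  (62497, [68881]), (62539, [68821]), (62549, [68813]), (62581, [68777]), (62591, [68767]),
  (62617, [68729]), (62659, [68683]), (62851, [68447]), (62897, [68399]), (62921, [68371]),
  (63031, [68239]), (63113, [68141]), (63149, [68099]), (63179, [68071]), (63199, [68041])]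

def weirdRows14Part7 : List (ℕ × List ℕ) := [
  (63211, [68023]), (63277, [67957]), (63331, [67891]), (63389, [67829]), (63439, [67763]),
  (63443, [67763]), (63467, [67733]), (63473, [67733]), (63499, [67699]), (63541, [67651]),
  (63559, [67631]), (63587, [67601]), (63589, [67601]), (63601, [67577, 67579]), (63607, [67577,
  67579]), (63617, [67559]), (63647, [67523]), (63649, [67523, 67531]), (63667, [67511]),
  (63689, [67489]), (63719, [67453]), (63727, [67429]), (63737, [67433]), (63761, [67391]),
  (63823, [67339]), (63929, [67213, 67217, 67219]), (64007, [67129]), (64013, [67129]),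
  (64063, [67061]), (64067, [67061]), (64081, [67033]), (64091, [67043]), (64109, [67021]),
  (64151, [66973, 66977]), (64153, [66973]), (64171, [66943, 66947]), (64217, [66889]),
  (64223, [66889]), (64271, [66841]), (64319, [66791]), (64373, [66733]), (64399, [66697, 66701]),
  (64403, [66697, 66701]), (64451, [66643]), (64453, [66643]), (64483, [66617]), (64513, [66571,
  66587]), (64553, [66541]), (64567, [66499]), (64577, [66509]), (64579, [66509]), (64601, [66463,
  66467]), (64609, [66467]), (64613, [66467]), (64679, [66403]), (64709, [66347]), (64717, [66359,
  66361]), (64793, [66271]), (64811, [66271]), (64849, [66221]), (64853, [66221]),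
  (64879, [66161]), (64891, [66161, 66169, 66173, 66179]), (64901, [66169, 66173, 66179]),
  (64937, [66103, 66107, 66109]), (64951, [66107, 66109]), (64997, [66041, 66047, 66067, 66071]),
  (65003, [66047, 66067, 66071]), (65011, [66047]), (65053, [65981, 65983, 65993]), (65063, [65981,
  65983, 65993]), (65071, [65981, 65983, 65993]), (65089, [65981, 65983]), (65119, [65881, 65899]),
  (65123, [65899]), (65129, [65899, 65921, 65927, 65929]), (65141, [65899, 65921, 65927, 65929]),
  (65147, [65899, 65921]), (65167, [65899]), (65171, [65899]), (65173, [65899]), (65203, [65777,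
  65789]), (65213, [65777, 65789, 65809]), (65239, [65789, 65809, 65827, 65831]), (65257, [65789,
  65809]), (65267, [65789]), (65269, [65789]), (65287, [65537, 65539, 65543]), (65293, [65537,
  65539, 65543, 65551, 65557]), (65309, [65537, 65539, 65543, 65551, 65557, 65563, 65579, 65581,
  65587]), (65323, [65537, 65539, 65543, 65551, 65557, 65563, 65579, 65581, 65587, 65599, 65609,
  65617, 65629]), (65327, [65537, 65539, 65543, 65551, 65557, 65563, 65579, 65581, 65587, 65599,
  65609, 65617, 65629, 65633]), (65353, [65537, 65539, 65543, 65551, 65557, 65563, 65579, 65581,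
  65587, 65599, 65609, 65617, 65629, 65633, 65647, 65651, 65657, 65677, 65687, 65699, 65701, 65707,
  65713]), (65357, [65537, 65539, 65543, 65551, 65557, 65563, 65579, 65581, 65587, 65599, 65609,
  65617, 65629, 65633, 65647, 65651, 65657, 65677, 65687, 65699, 65701, 65707]), (65371, [65537,
  65539, 65543, 65551, 65557, 65563, 65579, 65581, 65587, 65599, 65609, 65617, 65629, 65633, 65647,
  65651, 65657, 65677, 65687]), (65381, [65537, 65539, 65543, 65551, 65557, 65563, 65579, 65581,
  65587, 65599, 65609, 65617, 65629, 65633, 65647, 65651, 65657, 65677, 65687]), (65393, [65537,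
  65539, 65543, 65551, 65557, 65563, 65579, 65581, 65587, 65599, 65609, 65617, 65629, 65633, 65647,
  65651, 65657]), (65407, [65537, 65539, 65543, 65551, 65557, 65563, 65579, 65581, 65587, 65599,
  65609, 65617, 65629, 65633, 65647, 65651, 65657]), (65413, [65537, 65539, 65543, 65551, 65557,
  65563, 65579, 65581, 65587, 65599, 65609, 65617, 65629, 65633, 65647, 65651]), (65419, [65537,
  65539, 65543, 65551, 65557, 65563, 65579, 65581, 65587, 65599, 65609, 65617, 65629, 65633,
  65647]), (65423, [65537, 65539, 65543, 65551, 65557, 65563, 65579, 65581, 65587, 65599, 65609,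
  65617, 65629, 65633]), (65437, [65537, 65539, 65543, 65551, 65557, 65563, 65579, 65581, 65587,
  65599, 65609, 65617, 65629]), (65447, [65537, 65539, 65543, 65551, 65557, 65563, 65579, 65581,
  65587, 65599, 65609, 65617]), (65449, [65537, 65539, 65543, 65551, 65557, 65563, 65579, 65581,
  65587, 65599, 65609, 65617]), (65479, [65537, 65539, 65543, 65551, 65557, 65563, 65579, 65581,
  65587]), (65497, [65537, 65539, 65543, 65551, 65557, 65563]), (65519, [65537, 65539, 65543]),
  (65521, [65537, 65539, 65543])]

def weirdRows14 : List (ℕ × List ℕ) :=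

  weirdRows14Part1 ++ weirdRows14Part2 ++ weirdRows14Part3 ++ weirdRows14Part4 ++ weirdRows14Part5 ++ weirdRows14Part6 ++ weirdRows14Part7

/-- The rows of the table for `k`; there is no table unless `1 ≤ k ≤ 14`. -/
def weirdRows : ℕ → List (ℕ × List ℕ)
  | 1 => weirdRows1
  | 2 => weirdRows2
  | 3 => weirdRows3
  | 4 => weirdRows4
  | 5 => weirdRows5
  | 6 => weirdRows6
  | 7 => weirdRows7
  | 8 => weirdRows8
  | 9 => weirdRows9
  | 10 => weirdRows10
  | 11 => weirdRows11
  | 12 => weirdRows12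
  | 13 => weirdRows13
  | 14 => weirdRows14
  | _ => []

/-- The table for `k` as a list of pairs `(p, q)`, each standing for the number
`2 ^ k * p * q`. -/
def weirdTable (k : ℕ) : List (ℕ × ℕ) :=
  (weirdRows k).flatMap fun r => r.2.map fun q => (r.1, q)

/-! Write `M = 2 ^ (k + 1) - 1`, the sum of the divisors of `2 ^ k`. Every number from `0` to `M` is
a sum of distinct divisors of `2 ^ k`, so for odd `m` the subset sums of divisors of `2 ^ k * m` are
the combinations of the divisors of `m` with coefficients at most `M`. If a prime `p` is below `2 ^
(k + 1)`, then `2 ^ k * p = p * 1 + (2 ^ k - 1) * p` is such a sum, and so is every multiple of it.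
Abundance of `2 ^ k * p ^ m` forces this case, so these numbers are never weird. A weird `2 ^ k * p
* q` must have `p > M`; its divisors `2 ^ i * p * q` with `i < k` are then not abundant, which gives
primitivity.

For `p = M + d` with `d > 0`, weirdness means abundance together with the absence of a solution of
`a + b * p + c * q = p * q` with `a, b, c ≤ M`. Put `r = p - c`: then `a` and `b` are remainder and
quotient of `r * q` by `p`. Hence weirdness says that `r * q % p > M` for all `r ≥ d` with `r * q <
(M + 1) * p`, together with `d * q ≤ M * p` (`Good`, `good_iff_forall_ne`). In particular `d < M`,
so only finitely many `p` and `q` occur for each `k`.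

Let `t * p` be the multiple of `p` nearest to `q`. Raising `r` by one moves the remainder by `q - t
* p`, which is at most `M` in absolute value, while the forbidden interval from `0` to `M` has `M +
1` elements. The remainders therefore cannot cross it and form an arithmetic progression inside a
window of `d - 1` values (`Good.track`). So it suffices to test the smallest and the largest `r`
(`good_iff`), and a `q` far from `t * p` fails because the progression outgrows the window
(`Good.mul_lt`). Moreover each quotient `w = d * q / p` leaves a single candidate `q`
(`Good.eq_div`).

This yields a fast verified scan over `d ≤ w < M` which leaps over stretches far from multiples of
`p` (`scanStop_mul_le`, `scanAt_sound`). Primality is tested by one gcd with `(2 ^ (k + 1))!`, since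
all candidates that matter are below `(2 ^ (k + 1)) ^ 2`. The tables are confirmed by evaluating the
scan, and their lengths give the counts. -/

/-! ### The search procedure. -/

/-- `f n`, arranged so that the kernel evaluates `n` to a literal before it unfolds `f`. -/
def forceNat {α : Type} (n : ℕ) (f : ℕ → α) : α :=
  Nat.rec (f 0) (fun m _ => f m) (Nat.add n 1)

/-- The product `a * (a + 1) * ⋯ * (a + 2 ^ d - 1)`, computed by bisection. -/
def prodRange (a d : ℕ) : ℕ :=
  Nat.rec (fun a => a) (fun i ih a => Nat.mul (ih a) (ih (Nat.add a (Nat.pow 2 i)))) d a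

/-- Boolean test for coprimality of `n` and a much larger number `P`. -/
def coprimeTest (P n : ℕ) : Bool := Nat.beq (Nat.gcd (Nat.mod P n) n) 1

/-- Continues a scan at the larger of `w + 1` and `w'`. -/
def scanNext (ih : ℕ → List ℕ → Bool) (w w' : ℕ) (L : List ℕ) : Bool :=
  bif Nat.ble w' w then ih (Nat.succ w) L else ih w' L

/-- Checks that the first remaining entry of `L` is `q` and continues the scan behind it. -/
def scanTake (ih : ℕ → List ℕ → Bool) (w q : ℕ) (L : List ℕ) : Bool :=
  match L with
  | [] => false
  | a :: L' => bif Nat.beq a q then ih (Nat.succ w) L' else false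

/-- Tests whether `u + M < x < u + p` and `q` is coprime to `P`. -/
def scanTest (M P p u x q : ℕ) : Bool :=
  bif Nat.ble x (Nat.add u M) then false else
  bif Nat.ble (Nat.add u p) x then false else coprimeTest P q

/-- The index belonging to the smaller of `q'` and the first `q` with
`A / q ≤ d + (d - 1) / c`. -/
def scanStop (A p d c q' : ℕ) : ℕ :=
  forceNat (Nat.succ (Nat.div A (Nat.add d (Nat.succ (Nat.div (Nat.sub d 1) c))))) fun b =>
    Nat.div (Nat.mul d (bif Nat.ble b q' then b else q')) p

/-- A heuristic choice of the distance from the next multiple of `p` at which to resume a scan.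
The soundness of the scan does not depend on it. -/
def scanWidth (d e g a : ℕ) : ℕ :=
  bif Nat.ble a d then
    bif Nat.ble (Nat.add d d) (Nat.mul e g) then Nat.div g 2 else Nat.div (Nat.sub d 1) e
  -- Near `t * p` the progression has about `a - d` steps, so a good number there lies within about
  -- `(d - 1) / (a - d)` of `t * p`.
  else Nat.div (Nat.sub d 1) (Nat.sub a d)

/-- Continues a scan behind a stretch of numbers that are too far from the multiple `tp` of `p` to
be good. -/
def scanJump (M p d A : ℕ) (ih : ℕ → List ℕ → Bool) (w : ℕ) (L : List ℕ) (q e tp g : ℕ) : Bool :=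
  bif Nat.ble tp q then
    forceNat (scanStop A p d g (Nat.add tp (Nat.succ M))) fun w' => scanNext ih w w' L
  else
    forceNat (scanWidth d e g (Nat.div A tp)) fun c =>
    forceNat (scanStop A p d (Nat.succ c) (Nat.sub tp c)) fun w' => scanNext ih w w' L

/-- Treats the candidate `q` of index `w`, where `R = A / q` and `tp = t * p` is the multiple of `p`
nearest to `q`. -/
def scanStep (M P p d A : ℕ) (ih : ℕ → List ℕ → Bool) (w : ℕ) (L : List ℕ) (q R t tp : ℕ) : Bool :=
  forceNat (Nat.sub R d) fun e =>
  forceNat (Nat.add (Nat.sub q tp) (Nat.sub tp q)) fun g =>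
  -- After `e` steps of size `g` the remainder has moved by `e * g`, which must be less than `d` for
  -- it to stay in the window.
  bif Nat.ble d (Nat.mul e g) then scanJump M p d A ih w L q e tp g else
  bif Nat.ble (Nat.mul d q) (Nat.add (Nat.mul w p) M) then ih (Nat.succ w) L else
  bif scanTest M P p (Nat.mul (Nat.add w (Nat.mul e t)) p) (Nat.mul R q) q then
    scanTake ih w q L else ih (Nat.succ w) L

/-- Treats index `w`, whose only candidate is `((w + 1) * p - 1) / d`. -/
def scanAt (M P p d A : ℕ) (ih : ℕ → List ℕ → Bool) (w : ℕ) (L : List ℕ) : Bool :=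
  bif Nat.ble M w then L.isEmpty else
  forceNat (Nat.div (Nat.sub (Nat.mul (Nat.succ w) p) 1) d) fun q =>
  -- `(2 * q + p) / (2 * p)` is `q / p` rounded to the nearest integer.
  forceNat (Nat.div (Nat.add (Nat.add q q) p) (Nat.add p p)) fun t =>
    scanStep M P p d A ih w L q (Nat.div A q) t (Nat.mul t p)

/-- Checks that `L` lists in increasing order the numbers `q` coprime to `P` with `w * p ≤ d * q`
for which `2 ^ k * p * q` is weird, where `M = 2 ^ (k + 1) - 1`, `p = M + d` and
`A = (M + 1) * p - 1`. -/
def scan (M P p d A fuel : ℕ) : ℕ → List ℕ → Bool :=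
  Nat.rec (fun _ _ => false) (fun _ ih w L => forceNat w fun w => scanAt M P p d A ih w L) fuel

/-- Checks a row of the table. -/
def scanRow (M P p : ℕ) (L : List ℕ) : Bool :=
  forceNat (Nat.sub p M) fun d => forceNat (Nat.sub (Nat.mul (Nat.succ M) p) 1) fun A =>
    scan M P p d A (Nat.succ M) d L

/-- Checks the row for `p`, which may be missing if it is empty, and continues with `p + 2`. -/
def rowsNext (M P p : ℕ) (ih : ℕ → List (ℕ × List ℕ) → Bool) (rows : List (ℕ × List ℕ)) : Bool :=
  match rows with
  | [] => bif scanRow M P p [] then ih (Nat.add p 2) [] else false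
  | r :: rs =>
    bif Nat.beq r.1 p then
      bif scanRow M P p r.2 then ih (Nat.add p 2) rs else false
    else
      bif scanRow M P p [] then ih (Nat.add p 2) (r :: rs) else false

/-- Checks the rows for the `n` numbers `p, p + 2, p + 4, …`. -/
def rowsCheck (M P n : ℕ) : ℕ → List (ℕ × List ℕ) → Bool :=
  Nat.rec (fun _ rows => rows.isEmpty) (fun _ ih p rows => forceNat p fun p =>
    bif coprimeTest P p then rowsNext M P p ih rows else ih (Nat.add p 2) rows) n

/-- Checks the part of the table for `k` that belongs to the primes among the `n` numbers
`p, p + 2, p + 4, …`. -/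
def tableCheck (k p n : ℕ) (rows : List (ℕ × List ℕ)) : Bool :=
  forceNat (Nat.pow 2 (Nat.succ k)) fun N =>
  -- Here `P` is the factorial of `N = 2 ^ (k + 1)`.
  forceNat (prodRange 1 (Nat.succ k)) fun P => rowsCheck (Nat.sub N 1) P n p rows

/-! ### Divisor sums of `2 ^ k * m` with `m` odd. -/

open Finset

/-- Multiplying odd numbers by powers of two is injective. -/
theorem two_pow_mul_inj {i j x y : ℕ} (hx : Odd x) (hy : Odd y) (h : 2 ^ i * x = 2 ^ j * y) :
    i = j ∧ x = y := by
  have key : ∀ {i j x y : ℕ}, Odd y → 2 ^ i * x = 2 ^ j * y → i ≤ j := by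
    intro i j x y hy h
    have h1 : 2 ^ i ∣ 2 ^ j * y := h ▸ dvd_mul_right _ _
    have h2 : 2 ^ i ∣ 2 ^ j :=
      (Nat.Coprime.pow_left i (Nat.coprime_two_left.2 hy)).dvd_of_dvd_mul_right h1
    exact (Nat.pow_dvd_pow_iff_le_right (by norm_num)).1 h2
  have hij : i = j := le_antisymm (key hy h) (key hx h.symm)
  subst hij
  exact ⟨rfl, Nat.eq_of_mul_eq_mul_left (by positivity) h⟩

theorem odd_of_mem_divisors {m x : ℕ} (hm : Odd m) (hx : x ∈ m.divisors) : Odd x :=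
  hm.of_dvd_nat (Nat.dvd_of_mem_divisors hx)

theorem injOn_two_pow_mul {m : ℕ} (hm : Odd m) (k : ℕ) :
    Set.InjOn (fun y : ℕ × ℕ => 2 ^ y.2 * y.1) (m.divisors ×ˢ range (k + 1) : Finset (ℕ × ℕ)) := by
  rintro ⟨x, i⟩ hx ⟨y, j⟩ hy h
  simp only [coe_product, Set.mem_prod, mem_coe] at hx hy
  obtain ⟨h1, h2⟩ := two_pow_mul_inj (odd_of_mem_divisors hm hx.1) (odd_of_mem_divisors hm hy.1) h
  exact Prod.ext h2 h1

theorem divisors_two_pow_mul {m : ℕ} (hm : Odd m) (k : ℕ) :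
    (2 ^ k * m).divisors =
      (m.divisors ×ˢ range (k + 1)).image fun y : ℕ × ℕ => 2 ^ y.2 * y.1 := by
  have hm0 : m ≠ 0 := hm.pos.ne'
  ext d
  simp only [Nat.mem_divisors, mem_image, mem_product, mem_range, Prod.exists]
  constructor
  · rintro ⟨hd, -⟩
    obtain ⟨a, b, ha, hb, rfl⟩ := (Nat.dvd_mul).1 hd
    obtain ⟨i, hi, rfl⟩ := (Nat.dvd_prime_pow Nat.prime_two).1 ha
    exact ⟨b, i, ⟨⟨hb, hm0⟩, by omega⟩, rfl⟩
  · rintro ⟨x, i, ⟨⟨hx, -⟩, hi⟩, rfl⟩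
    exact ⟨mul_dvd_mul (pow_dvd_pow 2 (by omega)) hx, by positivity⟩

theorem sum_divisors_two_pow_mul {m : ℕ} (hm : Odd m) (k : ℕ) (f : ℕ → ℕ) :
    ∑ d ∈ (2 ^ k * m).divisors, f d = ∑ x ∈ m.divisors, ∑ i ∈ range (k + 1), f (2 ^ i * x) := by
  rw [divisors_two_pow_mul hm, sum_image (injOn_two_pow_mul hm k), sum_product]

/-- The sums of proper divisors of `2 ^ k * m`, `m` odd, are the combinations of the divisors of
`m` with coefficients below `2 ^ (k + 1)`, the coefficient of `m` being below `2 ^ k`. -/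
theorem exists_sum_properDivisors_two_pow_mul_iff {m : ℕ} (hm : Odd m) (k N : ℕ) :
    (∃ s ⊆ (2 ^ k * m).properDivisors, ∑ d ∈ s, d = N) ↔
      ∃ c : ℕ → ℕ, (∀ x, c x < 2 ^ (k + 1)) ∧ c m < 2 ^ k ∧ ∑ x ∈ m.divisors, c x * x = N := by
  have hm0 : 0 < 2 ^ k * m := mul_pos (by positivity) hm.pos
  constructor
  · rintro ⟨s, hs, rfl⟩
    refine ⟨fun x => ∑ i ∈ range (k + 1) with 2 ^ i * x ∈ s, 2 ^ i, fun x => ?_, ?_, ?_⟩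
    -- The coefficient of `x` collects the powers of two that accompany `x` in `s`; distinct powers
    -- with exponents at most `k` add up to less than `2 ^ (k + 1)`.
    · exact Nat.geomSum_lt le_rfl fun i hi => mem_range.1 (mem_filter.1 hi).1
    · refine Nat.geomSum_lt le_rfl fun i hi => ?_
      obtain ⟨h1, h2⟩ := mem_filter.1 hi
      rw [mem_range] at h1
      have h3 := (Nat.mem_properDivisors.1 (hs h2)).2
      -- Exponent `k` is excluded for `m` because `2 ^ k * m` is not a proper divisor of itself.
      have : i ≠ k := by rintro rfl; exact lt_irrefl _ h3
      omega
    · have h1 : ∑ d ∈ s, d = ∑ d ∈ (2 ^ k * m).divisors, if d ∈ s then d else 0 := by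
        rw [← sum_filter]
        congr 1
        ext d
        simp only [mem_filter]
        exact ⟨fun h => ⟨Nat.properDivisors_subset_divisors (hs h), h⟩, fun h => h.2⟩
      rw [h1, sum_divisors_two_pow_mul hm]
      refine sum_congr rfl fun x _ => ?_
      rw [sum_mul, sum_filter]
  · rintro ⟨c, hc, hcm, rfl⟩
    -- The divisor `2 ^ i * x` is used exactly when bit `i` of the coefficient of `x` is set.
    set T := (m.divisors ×ˢ range (k + 1)).filter fun y => (c y.1).testBit y.2 with hT
    have hTs : T ⊆ m.divisors ×ˢ range (k + 1) := filter_subset _ _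
    refine ⟨T.image fun y : ℕ × ℕ => 2 ^ y.2 * y.1, ?_, ?_⟩
    · intro d hd
      obtain ⟨y, hy, rfl⟩ := mem_image.1 hd
      have hd' : 2 ^ y.2 * y.1 ∈ (2 ^ k * m).divisors := by
        rw [divisors_two_pow_mul hm]
        exact mem_image_of_mem (fun y : ℕ × ℕ => 2 ^ y.2 * y.1) (hTs hy)
      refine Nat.mem_properDivisors.2 ⟨Nat.dvd_of_mem_divisors hd', ?_⟩
      refine lt_of_le_of_ne (Nat.divisor_le hd') fun h => ?_
      obtain ⟨h1, h2⟩ := mem_filter.1 hy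
      obtain ⟨h3, h4⟩ := two_pow_mul_inj (odd_of_mem_divisors hm (mem_product.1 h1).1) hm h
      rw [h3, h4, Nat.testBit_lt_two_pow hcm] at h2
      exact absurd h2 (by simp)
    · rw [sum_image ((injOn_two_pow_mul hm k).mono (by exact_mod_cast hTs)), hT, sum_filter,
        sum_product]
      refine sum_congr rfl fun x _ => ?_
      rw [← sum_filter, ← sum_mul]
      congr 1
      conv_rhs => rw [← sum_toFinset_bitIndices_two_pow (c x)]
      refine sum_congr ?_ fun _ _ => rfl
      ext i
      simp only [mem_filter, mem_range, List.mem_toFinset, Nat.mem_bitIndices]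
      refine ⟨fun h => h.2, fun h => ⟨?_, h⟩⟩
      by_contra hi
      rw [Nat.testBit_lt_two_pow ((hc x).trans_le (Nat.pow_le_pow_right (by norm_num)
        (not_lt.1 hi)))] at h
      exact absurd h (by simp)

theorem pseudoperfect_two_pow_mul_iff {m : ℕ} (hm : Odd m) (k : ℕ) :
    (2 ^ k * m).Pseudoperfect ↔
      ∃ c : ℕ → ℕ, (∀ x, c x < 2 ^ (k + 1)) ∧ c m < 2 ^ k ∧
        ∑ x ∈ m.divisors, c x * x = 2 ^ k * m := by
  rw [Nat.Pseudoperfect, exists_sum_properDivisors_two_pow_mul_iff hm]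
  exact and_iff_right (mul_pos (by positivity) hm.pos)

/-! ### Numbers `2 ^ k * p ^ m` are not weird. -/

theorem Nat.Pseudoperfect.mul_left {n : ℕ} (h : n.Pseudoperfect) {m : ℕ} (hm : 0 < m) :
    (m * n).Pseudoperfect := by
  obtain ⟨hn, s, hs, hsum⟩ := h
  refine ⟨mul_pos hm hn, s.image (m * ·), ?_, ?_⟩
  · intro d hd
    obtain ⟨x, hx, rfl⟩ := mem_image.1 hd
    obtain ⟨h1, h2⟩ := Nat.mem_properDivisors.1 (hs hx)
    exact Nat.mem_properDivisors.2 ⟨mul_dvd_mul_left m h1, Nat.mul_lt_mul_of_pos_left h2 hm⟩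
  · rw [sum_image fun x _ y _ h => Nat.eq_of_mul_eq_mul_left hm h, ← mul_sum, hsum]

/-- The representation is `p * 1 + (2 ^ k - 1) * p`: the hypothesis makes `p` an admissible
coefficient of the divisor `1`. -/
theorem pseudoperfect_two_pow_mul_prime {k p : ℕ} (hp : p.Prime) (ho : Odd p)
    (h : p < 2 ^ (k + 1)) : (2 ^ k * p).Pseudoperfect := by
  rw [pseudoperfect_two_pow_mul_iff ho]
  have h2 : 0 < 2 ^ k := by positivity
  have h3 : 2 ^ (k + 1) = 2 * 2 ^ k := by ring
  refine ⟨fun x => if x = 1 then p else 2 ^ k - 1, fun x => ?_, ?_, ?_⟩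
  · dsimp only
    split_ifs <;> omega
  · simp only [hp.ne_one, if_false]; omega
  · rw [hp.divisors, sum_pair hp.one_lt.ne]
    simp only [if_true, hp.ne_one, if_false]
    obtain ⟨a, ha⟩ := Nat.exists_eq_add_of_lt h2
    rw [ha]
    simp
    ring

theorem abundant_two_pow_mul_iff {m : ℕ} (hm : Odd m) (k : ℕ) :
    (2 ^ k * m).Abundant ↔ 2 ^ (k + 1) * m < (2 ^ (k + 1) - 1) * ∑ x ∈ m.divisors, x := by
  rw [Nat.abundant_iff_sum_divisors, sum_divisors_two_pow_mul hm, mul_sum]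
  have : ∀ x, ∑ i ∈ range (k + 1), 2 ^ i * x = (2 ^ (k + 1) - 1) * x := fun x => by
    rw [← sum_mul, Nat.geomSum_eq le_rfl]
    simp
  simp only [this]
  rw [show 2 * (2 ^ k * m) = 2 ^ (k + 1) * m by ring]

/-- With `M = 2 ^ (k + 1) - 1` and `S = 1 + p + ⋯ + p ^ (m - 1)`, abundance reads `(M + 1) * p ^ m <
M * (S + p ^ m)`, that is `p ^ m < M * S`. Since `p ^ m = (p - 1) * S + 1`, this is impossible for
`p ≥ M + 1`. -/
theorem lt_two_pow_of_abundant_two_pow_mul_pow {k p m : ℕ} (hp : p.Prime) (ho : Odd p)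
    (h : (2 ^ k * p ^ m).Abundant) : p < 2 ^ (k + 1) := by
  rw [abundant_two_pow_mul_iff ho.pow, Nat.sum_divisors_prime_pow hp, sum_range_succ] at h
  have h1 : p * ∑ i ∈ range m, p ^ i + 1 = ∑ i ∈ range m, p ^ i + p ^ m := by
    rw [← sum_range_succ, sum_range_succ', mul_sum]
    simp [pow_succ']
  by_contra! hle
  obtain ⟨N, hN⟩ : ∃ N, 2 ^ (k + 1) = N + 1 := Nat.exists_eq_succ_of_ne_zero (by positivity)
  rw [hN] at h hle
  have h2 := Nat.mul_le_mul_right (∑ i ∈ range m, p ^ i) hle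
  simp only [Nat.add_sub_cancel] at h
  nlinarith

/-- Abundance makes `p` small, hence `2 ^ k * p` pseudoperfect, and this passes to its multiple `2 ^
k * p ^ m`. For `m = 0` the number is a power of two, which is not abundant. -/
theorem not_weird_two_pow_mul_pow {k p : ℕ} (m : ℕ) (hp : p.Prime) (ho : Odd p) :
    ¬ (2 ^ k * p ^ m).Weird := by
  rintro ⟨ha, hn⟩
  have h := lt_two_pow_of_abundant_two_pow_mul_pow hp ho ha
  rcases m with _ | m
  · rw [pow_zero, abundant_two_pow_mul_iff odd_one] at ha
    simp at ha
    omega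
  · refine hn ?_
    rw [show 2 ^ k * p ^ (m + 1) = p ^ m * (2 ^ k * p) by ring]
    exact (pseudoperfect_two_pow_mul_prime hp ho h).mul_left (pow_pos hp.pos m)

/-! ### Weird numbers `2 ^ k * p * q` and their primitivity. -/

theorem divisors_prime_mul_prime {p q : ℕ} (hp : p.Prime) (hq : q.Prime) :
    (p * q).divisors = {1, p, q, p * q} := by
  ext d
  simp only [Nat.mem_divisors, mem_insert, mem_singleton]
  constructor
  · rintro ⟨hd, -⟩
    obtain ⟨a, b, ha, hb, rfl⟩ := (Nat.dvd_mul).1 hd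
    rcases (Nat.dvd_prime hp).1 ha with rfl | rfl <;> rcases (Nat.dvd_prime hq).1 hb with rfl | rfl <;>
      simp
  · have h0 : p * q ≠ 0 := mul_ne_zero hp.ne_zero hq.ne_zero
    rintro (rfl | rfl | rfl | rfl) <;> simp [h0]

theorem sum_divisors_prime_mul_prime {p q : ℕ} (hp : p.Prime) (hq : q.Prime) (h : p < q)
    (f : ℕ → ℕ) : ∑ x ∈ (p * q).divisors, f x = f 1 + f p + f q + f (p * q) := by
  have h1 := hp.one_lt
  have h2 : q < p * q := by nlinarith
  rw [divisors_prime_mul_prime hp hq, sum_insert, sum_insert, sum_pair]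
  · ring
  · omega
  · simp only [mem_insert, mem_singleton]; omega
  · simp only [mem_insert, mem_singleton]; omega

/-- With `M = 2 ^ (k + 1) - 1`, the condition `(M + 1) * p * q < M * (1 + p + q + p * q)` loses `M *
p * q` on both sides. -/
theorem abundant_two_pow_mul_mul_iff {k p q : ℕ} (hp : p.Prime) (hq : q.Prime) (hpo : Odd p)
    (hqo : Odd q) (h : p < q) :
    (2 ^ k * (p * q)).Abundant ↔ p * q < (2 ^ (k + 1) - 1) * (1 + p + q) := by
  rw [abundant_two_pow_mul_iff (hpo.mul hqo), sum_divisors_prime_mul_prime hp hq h]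
  obtain ⟨N, hN⟩ : ∃ N, 2 ^ (k + 1) = N + 1 := Nat.exists_eq_succ_of_ne_zero (by positivity)
  rw [hN, Nat.add_sub_cancel]
  constructor <;> intro h <;> nlinarith

/-- A small `p` would make `2 ^ k * p`, hence its multiple, pseudoperfect. For `p ≥ 2 ^ (k + 1)` the
coefficient of `p * q` in a representation must take its maximal value `2 ^ k - 1`, so that exactly
one `p * q` remains for the divisors `1`, `p` and `q`. -/
theorem weird_two_pow_mul_mul_iff {k p q : ℕ} (hp : p.Prime) (hq : q.Prime) (hpo : Odd p)
    (hqo : Odd q) (h : p < q) :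
    (2 ^ k * (p * q)).Weird ↔ 2 ^ (k + 1) ≤ p ∧ p * q < (2 ^ (k + 1) - 1) * (1 + p + q) ∧
      ∀ a b c, a < 2 ^ (k + 1) → b < 2 ^ (k + 1) → c < 2 ^ (k + 1) →
        a + b * p + c * q ≠ p * q := by
  have h1 := hp.one_lt
  have h2 : q < p * q := by nlinarith
  have hk : 0 < 2 ^ k := by positivity
  have hk' : 2 ^ (k + 1) = 2 * 2 ^ k := by ring
  rw [Nat.Weird, abundant_two_pow_mul_mul_iff hp hq hpo hqo h,
    pseudoperfect_two_pow_mul_iff (hpo.mul hqo)]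
  simp only [sum_divisors_prime_mul_prime hp hq h]
  constructor
  · rintro ⟨ha, hn⟩
    refine ⟨?_, ha, ?_⟩
    · by_contra! hlt
      refine hn ((pseudoperfect_two_pow_mul_iff (hpo.mul hqo) k).1 ?_ |>.imp fun c hc => ?_)
      · rw [show 2 ^ k * (p * q) = q * (2 ^ k * p) by ring]
        exact (pseudoperfect_two_pow_mul_prime hp hpo hlt).mul_left hq.pos
      · rwa [sum_divisors_prime_mul_prime hp hq h] at hc
    · intro a b c ha hb hc he
      refine hn ⟨fun x => if x = 1 then a else if x = p then b else if x = q then c else 2 ^ k - 1,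
        fun x => ?_, ?_, ?_⟩
      · dsimp only
        split_ifs <;> omega
      · dsimp only
        rw [if_neg (by omega), if_neg (by omega), if_neg (by omega)]; omega
      · dsimp only
        rw [if_pos rfl, if_neg (by omega), if_pos rfl, if_neg (by omega), if_neg (by omega),
          if_pos rfl, if_neg (by omega), if_neg (by omega), if_neg (by omega), mul_one, he]
        obtain ⟨j, hj⟩ : ∃ j, 2 ^ k = j + 1 := Nat.exists_eq_succ_of_ne_zero hk.ne'
        rw [hj, Nat.add_sub_cancel]
        ring
  · rintro ⟨hle, ha, hn⟩
    refine ⟨ha, ?_⟩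
    rintro ⟨c, hc, hcm, he⟩
    refine hn _ _ _ (hc 1) (hc p) (hc q) ?_
    have b1 := Nat.le_sub_one_of_lt (hc 1)
    have b2 := Nat.mul_le_mul_right p (Nat.le_sub_one_of_lt (hc p))
    have b3 := Nat.mul_le_mul_right q (Nat.le_sub_one_of_lt (hc q))
    obtain ⟨j, hj⟩ := Nat.exists_eq_add_of_lt hcm
    obtain ⟨N, hN⟩ : ∃ N, 2 ^ (k + 1) = N + 1 := Nat.exists_eq_succ_of_ne_zero (by positivity)
    rw [hN, Nat.add_sub_cancel] at b1 b2 b3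
    rw [hN] at hle
    rw [hj] at he
    -- If the coefficient of `p * q` were smaller, the other three terms would have to supply at
    -- least `2 * p * q`, more than `N * (1 + p + q)` when `N < p < q`.
    have hj0 : j = 0 := by
      by_contra hj0
      have h5 : p * q ≤ j * (p * q) := Nat.le_mul_of_pos_left _ (Nat.pos_of_ne_zero hj0)
      have h6 := Nat.mul_le_mul_right q hle
      have h7 := Nat.mul_le_mul_left p (hle.trans h.le)
      nlinarith
    subst hj0
    linarith

/-- Weird numbers of the form `2 ^ k * p * q` are primitive. -/
theorem Nat.Weird.primitiveWeird_two_pow_mul_mul {k p q : ℕ} (hp : p.Prime) (hq : q.Prime)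
    (hpo : Odd p) (hqo : Odd q) (h : p < q) (hw : (2 ^ k * p * q).Weird) :
    PrimitiveWeird (2 ^ k * p * q) := by
  refine ⟨hw, fun d hd hdw => ?_⟩
  obtain ⟨hdd, hlt⟩ := Nat.mem_properDivisors.1 hd
  rw [mul_assoc] at hw hdd hlt
  have hmem : d ∈ (2 ^ k * (p * q)).divisors := Nat.mem_divisors.2 ⟨hdd, by omega⟩
  rw [divisors_two_pow_mul (hpo.mul hqo), divisors_prime_mul_prime hp hq] at hmem
  obtain ⟨⟨x, i⟩, hy, rfl⟩ := mem_image.1 hmem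
  simp only [mem_product, mem_insert, mem_singleton, mem_range] at hy
  obtain ⟨hx, hi⟩ := hy
  dsimp only at hdw hlt
  rcases hx with rfl | rfl | rfl | rfl
  · exact not_weird_two_pow_mul_pow (k := i) 0 hp hpo (by simpa using hdw)
  · exact not_weird_two_pow_mul_pow (k := i) 1 hp hpo (by simpa using hdw)
  · exact not_weird_two_pow_mul_pow (k := i) 1 hq hqo (by simpa using hdw)
  · have hik : i < k := by
      rcases Nat.lt_or_ge i k with h' | h'
      · exact h'
      · have : i = k := by omega
        subst this
        exact absurd hlt (lt_irrefl _)
    -- The remaining divisor is `2 ^ i * p * q` with `i < k`. For `N = 2 ^ (i + 1) - 1` both primes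
    -- are at least `2 * N + 2`, whence `p * q ≥ (N + 1) * (p + q)`, which contradicts abundance.
    have h1 := ((weird_two_pow_mul_mul_iff hp hq hpo hqo h).1 hw).1
    have h2 := (abundant_two_pow_mul_mul_iff hp hq hpo hqo h).1 hdw.1
    have h3 : 2 * 2 ^ (i + 1) ≤ 2 ^ (k + 1) := by
      rw [← pow_succ']
      exact Nat.pow_le_pow_right (by norm_num) (by omega)
    obtain ⟨N, hN⟩ : ∃ N, 2 ^ (i + 1) = N + 1 := Nat.exists_eq_succ_of_ne_zero (by positivity)
    rw [hN, Nat.add_sub_cancel] at h2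
    have h4 : 2 * N + 2 ≤ p := by omega
    nlinarith [Nat.mul_le_mul_right q h4, Nat.mul_le_mul_left p (h4.trans h.le)]

/-! ### Weirdness as a condition on remainders modulo `p`. -/

/-- The arithmetic condition on `q`, for `p = M + d` and `M = 2 ^ (k + 1) - 1`, which characterizes
the weird numbers `2 ^ k * p * q`. -/
def Good (M d p q : ℕ) : Prop :=
  p < q ∧ d * q ≤ M * p ∧ ∀ r, d ≤ r → r * q < (M + 1) * p → M < r * q % p

/-- Substituting `r = p - c` turns `a + b * p + c * q = p * q` into `r * q = a + b * p`. As `a ≤ M <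
p`, this is division of `r * q` by `p`; the bound on `c` becomes `d ≤ r`, and the bound on `b`
becomes `r * q < (M + 1) * p`. -/
theorem good_iff_forall_ne {M d p q : ℕ} (hp : p = M + d) (hd : 0 < d) (hM : 0 < M) (hpq : p < q) :
    Good M d p q ↔ p * q < M * (1 + p + q) ∧
      ∀ a b c, a ≤ M → b ≤ M → c ≤ M → a + b * p + c * q ≠ p * q := by
  have hp0 : 0 < p := by omega
  have hpe : p * q = M * q + d * q := by rw [hp, add_mul]
  constructor
  · rintro ⟨-, h1, h2⟩
    refine ⟨by nlinarith, fun a b c ha hb hc he => ?_⟩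
    obtain ⟨r, hr⟩ : ∃ r, p = c + r := Nat.exists_eq_add_of_le (by omega)
    have h3 : r * q = a + p * b := by
      have : p * q = c * q + r * q := by rw [hr, add_mul]
      linarith [mul_comm b p]
    have h4 := h2 r (by omega) (by nlinarith)
    rw [h3, Nat.add_mul_mod_self_left, Nat.mod_eq_of_lt (by omega)] at h4
    omega
  · rintro ⟨h1, h2⟩
    have key : ∀ r, d ≤ r → r * q < (M + 1) * p → M < r * q % p := by
      intro r hr hrq
      by_contra! hle
      have hrp : r ≤ p := by
        by_contra! h
        nlinarith
      have hb : r * q / p ≤ M := by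
        have := (Nat.div_lt_iff_lt_mul hp0).2 hrq
        omega
      refine h2 (r * q % p) (r * q / p) (p - r) hle hb (by omega) ?_
      have h3 : (p - r) * q + r * q = p * q := by rw [← add_mul, Nat.sub_add_cancel hrp]
      have h4 := Nat.mod_add_div (r * q) p
      linarith [mul_comm p (r * q / p)]
    refine ⟨hpq, ?_, key⟩
    -- Abundance alone gives `d * q < M * p + M`. A quotient `d * q / p = M` is ruled out because
    -- its remainder would exceed `M`; this sharpens the bound to `d * q ≤ M * p`.
    have h3 := key d le_rfl (by nlinarith)
    have h4 := Nat.mod_add_div (d * q) p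
    have h5 : d * q / p < M := by
      by_contra! h
      have := Nat.mul_le_mul_left p h
      nlinarith
    have h6 := Nat.mod_lt (d * q) hp0
    have h7 := Nat.mul_le_mul_left p h5
    rw [Nat.succ_eq_add_one] at h7
    nlinarith

/-- This bounds the search: only primes `p < 2 * M` can occur. -/
theorem Good.lt {M d p q : ℕ} (h : Good M d p q) (hM : 0 < M) : d < M := by
  obtain ⟨h1, h2, -⟩ := h
  by_contra! hd
  have h3 := Nat.mul_le_mul_right q hd
  have h4 := Nat.mul_lt_mul_of_pos_left h1 hM
  omega

theorem weird_two_pow_mul_mul_iff_good {k p q : ℕ} (hp : p.Prime) (hq : q.Prime) (hpo : Odd p)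
    (hqo : Odd q) (h : p < q) :
    (2 ^ k * p * q).Weird ↔ 2 ^ (k + 1) ≤ p ∧
      Good (2 ^ (k + 1) - 1) (p - (2 ^ (k + 1) - 1)) p q := by
  rw [mul_assoc, weird_two_pow_mul_mul_iff hp hq hpo hqo h]
  have h1 : 2 ≤ 2 ^ (k + 1) := by
    rw [pow_succ]
    have : 0 < 2 ^ k := by positivity
    omega
  refine and_congr_right fun hle => ?_
  rw [good_iff_forall_ne (by omega) (by omega) (by omega) h]
  refine and_congr_right fun _ => forall_congr' fun a => forall_congr' fun b =>
    forall_congr' fun c => ?_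
  rw [Nat.lt_iff_le_pred (by omega), Nat.lt_iff_le_pred (by omega), Nat.lt_iff_le_pred (by omega)]

/-! ### The progression of remainders. -/

/-- If `q` differs by at most `M` from `t * p`, the remainders of `r * q` modulo `p` stay in the
interval between `M` and `p` without wrapping around. -/
theorem Good.track {M d p q t w : ℕ} (h : Good M d p q) (hp : p = M + d) (ht : t * p ≤ q + M)
    (ht' : q ≤ t * p + M) (hw : w * p + M < d * q) (hw' : d * q < w * p + p) (j : ℕ)
    (hj : (d + j) * q < (M + 1) * p) :
    (w + j * t) * p + M < (d + j) * q ∧ (d + j) * q < (w + j * t) * p + p := by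
  induction j with
  | zero => simpa using ⟨hw, hw'⟩
  | succ j ih =>
    have e1 : (d + (j + 1)) * q = (d + j) * q + q := by ring
    have e2 : (w + (j + 1) * t) * p = (w + j * t) * p + t * p := by ring
    obtain ⟨i1, i2⟩ := ih (by omega)
    obtain ⟨y, hy⟩ : ∃ y, (d + (j + 1)) * q = (w + (j + 1) * t) * p + y :=
      Nat.exists_eq_add_of_le (by omega)
    have hm := h.2.2 _ (Nat.le_add_right d (j + 1)) hj
    rw [hy, Nat.mul_add_mod'] at hm
    -- A step of at most `M` from below `p` to `p` or beyond would land at a remainder below `M`,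
    -- inside the forbidden interval. A step downwards keeps `y` positive, and then the remainder
    -- condition gives `M < y`.
    have hyp : y < p := by
      by_contra! hle
      rw [Nat.mod_eq_sub_mod hle, Nat.mod_eq_of_lt (by omega)] at hm
      omega
    rw [Nat.mod_eq_of_lt hyp] at hm
    omega

theorem Good.exists_index {M d p q : ℕ} (h : Good M d p q) (hp0 : 0 < p) :
    ∃ w, w * p + M < d * q ∧ d * q < w * p + p := by
  have h1 := h.2.2 d le_rfl (by nlinarith [h.2.1])
  have h2 := Nat.mod_add_div (d * q) p
  have h3 := Nat.mod_lt (d * q) hp0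
  exact ⟨d * q / p, by linarith [mul_comm p (d * q / p)], by linarith [mul_comm p (d * q / p)]⟩

/-- The values for `r = d` and `r = d + j` both lie strictly between `M` and `p = M + d` after the
multiples of `p` are removed. They differ by `j * (q - t * p)`, so this drift is less than `d` in
absolute value. -/
theorem Good.mul_lt {M d p q t : ℕ} (h : Good M d p q) (hp : p = M + d) (hp0 : 0 < p)
    (ht : t * p ≤ q + M) (ht' : q ≤ t * p + M) (j : ℕ) (hj : (d + j) * q < (M + 1) * p) :
    j * q < j * (t * p) + d ∧ j * (t * p) < j * q + d := by
  obtain ⟨w, hw, hw'⟩ := h.exists_index hp0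
  obtain ⟨h1, h2⟩ := h.track hp ht ht' hw hw' j hj
  constructor <;> nlinarith

/-- The numbers `r * q`, reduced by the matching multiples of `p`, form an arithmetic progression in
`r`. Such a progression stays between `M` and `p` as soon as its two end terms do; `d + e` is the
last relevant `r`. -/
theorem good_iff {M d p q t w e : ℕ} (hp : p = M + d) (hpq : p < q)
    (hwM : w < M) (ht : t * p ≤ q + M) (ht' : q ≤ t * p + M) (hw : w * p ≤ d * q)
    (hw' : d * q < w * p + p) (he : (d + e) * q < (M + 1) * p) (he' : (M + 1) * p ≤ (d + e + 1) * q) :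
    Good M d p q ↔ w * p + M < d * q ∧ (w + e * t) * p + M < (d + e) * q ∧
      (d + e) * q < (w + e * t) * p + p := by
  constructor
  · intro h
    have h1 := h.2.2 d le_rfl (by nlinarith)
    obtain ⟨y, hy⟩ := Nat.exists_eq_add_of_le hw
    rw [hy, Nat.mul_add_mod', Nat.mod_eq_of_lt (by omega)] at h1
    exact ⟨by omega, h.track hp ht ht' (by omega) hw' e he⟩
  · rintro ⟨h1, h2, h3⟩
    refine ⟨hpq, by nlinarith, fun r hr hrq => ?_⟩
    obtain ⟨j, rfl⟩ := Nat.exists_eq_add_of_le hr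
    have hje : j ≤ e := by
      by_contra! hlt
      have := Nat.mul_le_mul_right q (show d + e + 1 ≤ d + j by omega)
      omega
    have key : (w + j * t) * p + M < (d + j) * q ∧ (d + j) * q < (w + j * t) * p + p := by
      obtain ⟨i, rfl⟩ := Nat.exists_eq_add_of_le hje
      have e1 : (w + j * t) * p = w * p + j * (t * p) := by ring
      have e2 : (w + (j + i) * t) * p = w * p + j * (t * p) + i * (t * p) := by ring
      have e3 : (d + (j + i)) * q = d * q + j * q + i * q := by ring
      have e4 : (d + j) * q = d * q + j * q := by ring
      rw [e2, e3] at h2 h3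
      rw [e1, e4]
      -- The progression decreases or increases according to the sign of `q - t * p`; in either case
      -- the term at `j` lies between those at `0` and `j + i`.
      rcases le_total q (t * p) with hq | hq
      · have k1 := Nat.mul_le_mul_left j hq
        have k2 := Nat.mul_le_mul_left i hq
        omega
      · have k1 := Nat.mul_le_mul_left j hq
        have k2 := Nat.mul_le_mul_left i hq
        omega
    obtain ⟨y, hy⟩ : ∃ y, (d + j) * q = (w + j * t) * p + y :=
      Nat.exists_eq_add_of_le (by omega)
    rw [hy, Nat.mul_add_mod', Nat.mod_eq_of_lt (by omega)]
    omega

/-- The only candidate for a good `q` with `d * q` between `w * p` and `(w + 1) * p`. -/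
theorem Good.eq_div {M d p q w : ℕ} (h : Good M d p q) (hp : p = M + d) (hd : 0 < d)
    (hw : w * p ≤ d * q) (hw' : d * q < (w + 1) * p) : q = ((w + 1) * p - 1) / d := by
  have h1 := h.2.2 d le_rfl (by nlinarith [h.2.1])
  obtain ⟨y, hy⟩ := Nat.exists_eq_add_of_le hw
  have e1 : (w + 1) * p = w * p + p := by ring
  rw [hy, Nat.mul_add_mod', Nat.mod_eq_of_lt (by omega)] at h1
  symm
  -- From `d * q > w * p + M` and `p = M + d` follows `d * (q + 1) > (w + 1) * p`, so `q` is the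
  -- largest number with `d * q < (w + 1) * p`.
  rw [Nat.div_eq_iff hd]
  have e2 : q * d = d * q := mul_comm _ _
  omega

/-! ### Evaluation rules and the primality test. -/

theorem forceNat_eq {α : Type} (n : ℕ) (f : ℕ → α) : forceNat n f = f n := rfl

theorem cond_ble {α : Type} (a b : ℕ) (x y : α) :
    (bif Nat.ble a b then x else y) = if a ≤ b then x else y := by
  rw [cond_eq_ite]
  simp only [Nat.ble_eq]

theorem cond_beq {α : Type} (a b : ℕ) (x y : α) :
    (bif Nat.beq a b then x else y) = if a = b then x else y := by
  rw [cond_eq_ite]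
  simp only [Nat.beq_eq]

/-- Started at `a = 1`, the product is `(2 ^ d)!`. -/
theorem prodRange_eq_ascFactorial (d : ℕ) : ∀ a, prodRange a d = a.ascFactorial (2 ^ d) := by
  induction d with
  | zero => intro a; simp [Nat.ascFactorial, prodRange]
  | succ d ih =>
    intro a
    have h : prodRange a (d + 1) = prodRange a d * prodRange (a + 2 ^ d) d := rfl
    rw [h, ih, ih, Nat.ascFactorial_mul_ascFactorial, pow_succ, mul_two]

theorem coprimeTest_iff (P n : ℕ) : coprimeTest P n = true ↔ n.Coprime P := by
  rw [coprimeTest, Nat.beq_eq, Nat.gcd_comm, Nat.Coprime, Nat.gcd_comm n P]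
  change Nat.gcd n (P % n) = 1 ↔ _
  rw [Nat.gcd_comm n, ← Nat.gcd_rec, Nat.gcd_comm]

/-- A composite `n < N * N` has a prime factor below `N`, which divides `N!`; a prime above `N` does
not divide `N!`. -/
theorem coprimeTest_factorial_iff {N n : ℕ} (h1 : 1 < n) (h2 : N < n) (h3 : n < N * N) :
    coprimeTest N.factorial n = true ↔ n.Prime := by
  rw [coprimeTest_iff, Nat.coprime_comm]
  constructor
  · intro h
    rw [Nat.coprime_comm, Nat.coprime_factorial_iff h1.ne'] at h
    by_contra hn
    have := Nat.minFac_sq_le_self (by omega) hn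
    nlinarith
  · exact fun h => (h.coprime_factorial_of_lt h2).symm

/-! ### Correctness of the scan of a row. -/

/-- `L` lists the good `q` coprime to `P` with `w * p ≤ d * q`. -/
def ScanSpec (M P p d w : ℕ) (L : List ℕ) : Prop :=
  ∀ q, q ∈ L ↔ w * p ≤ d * q ∧ Good M d p q ∧ coprimeTest P q = true

theorem scanSpec_nil {M P p d w : ℕ} (hp0 : 0 < p) (hw : M ≤ w) : ScanSpec M P p d w [] := by
  intro q
  simp only [List.not_mem_nil, false_iff]
  rintro ⟨h1, h2, -⟩
  -- The bound `d * q ≤ M * p` leaves only `d * q = M * p` at index `M` or later, and there the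
  -- remainder is `0` instead of exceeding `M`.
  obtain ⟨v, h3, h4⟩ := h2.exists_index hp0
  have h5 := h2.2.1
  have h6 := Nat.mul_le_mul_right p hw
  have h7 : v < M := by
    by_contra! h
    have := Nat.mul_le_mul_right p h
    omega
  have h8 := Nat.mul_le_mul_right p h7
  rw [Nat.succ_mul] at h8
  omega

theorem ScanSpec.of_jump {M P p d w w' : ℕ} {L : List ℕ} (h : ScanSpec M P p d w' L) (hw : w ≤ w')
    (hj : ∀ q, Good M d p q → w * p ≤ d * q → w' * p ≤ d * q) : ScanSpec M P p d w L := by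
  intro q
  rw [h q]
  refine ⟨fun ⟨h1, h2⟩ => ⟨(Nat.mul_le_mul_right p hw).trans h1, h2⟩,
    fun ⟨h1, h2⟩ => ⟨hj q h2.1 h1, h2⟩⟩

/-- Index `w` has only one candidate by `Good.eq_div`; if it fails, nothing is lost by passing to `w
+ 1`. -/
theorem ScanSpec.skip {M P p d w : ℕ} {L : List ℕ} (h : ScanSpec M P p d (w + 1) L)
    (hp : p = M + d) (hd : 0 < d)
    (hq : ¬ (Good M d p (((w + 1) * p - 1) / d) ∧ coprimeTest P (((w + 1) * p - 1) / d) = true)) :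
    ScanSpec M P p d w L := by
  intro q
  rw [h q]
  refine ⟨fun ⟨h1, h2⟩ => ⟨(Nat.mul_le_mul_right p (Nat.le_succ w)).trans h1, h2⟩,
    fun ⟨h1, h2⟩ => ⟨?_, h2⟩⟩
  by_contra! hlt
  have := h2.1.eq_div hp hd h1 hlt
  rw [← this] at hq
  exact hq h2

theorem ScanSpec.cons {M P p d w : ℕ} {L : List ℕ} (h : ScanSpec M P p d (w + 1) L)
    (hp : p = M + d) (hd : 0 < d) (hw : w * p ≤ d * (((w + 1) * p - 1) / d))
    (hq : Good M d p (((w + 1) * p - 1) / d) ∧ coprimeTest P (((w + 1) * p - 1) / d) = true) :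
    ScanSpec M P p d w ((((w + 1) * p - 1) / d) :: L) := by
  intro q
  rw [List.mem_cons, h q]
  constructor
  · rintro (rfl | ⟨h1, h2⟩)
    · exact ⟨hw, hq⟩
    · exact ⟨(Nat.mul_le_mul_right p (Nat.le_succ w)).trans h1, h2⟩
  · rintro ⟨h1, h2⟩
    by_cases hlt : d * q < (w + 1) * p
    · exact Or.inl (h2.1.eq_div hp hd h1 hlt)
    · exact Or.inr ⟨not_lt.1 hlt, h2⟩

/-- Let `X = (d - 1) / c`, so that `(X + 1) * c ≥ d`. At distance at least `c` from `t * p`, a drift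
of `X + 1` steps leaves the window by `Good.mul_lt`. Hence a good `q < q'` cannot have that many
steps available, which means `A / (d + X + 1) < q`. -/
theorem scanStop_mul_le {M A p d c t q q' : ℕ} (hp : p = M + d) (hp0 : 0 < p)
    (hA : A + 1 = (M + 1) * p) (hc : 0 < c) (h : Good M d p q)
    (ht : q < q' → t * p ≤ q + M ∧ q ≤ t * p + M ∧ (t * p + c ≤ q ∨ q + c ≤ t * p)) :
    scanStop A p d c q' * p ≤ d * q := by
  rw [scanStop, forceNat_eq]
  change d * (bif Nat.ble (A / (d + ((d - 1) / c + 1)) + 1) q' then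
    A / (d + ((d - 1) / c + 1)) + 1 else q') / p * p ≤ _
  set X := (d - 1) / c with hX
  have hX' : d ≤ (X + 1) * c := by
    have := Nat.lt_mul_div_succ (d - 1) hc
    rw [← hX, mul_comm] at this
    omega
  clear_value X
  have key : A / (d + (X + 1)) + 1 ≤ q ∨ q' ≤ q := by
    by_contra! hlt
    obtain ⟨h1, h2⟩ := hlt
    obtain ⟨h3, h4, h5⟩ := ht h2
    have h6 : (d + (X + 1)) * q ≤ A := by
      rw [mul_comm]
      exact (Nat.le_div_iff_mul_le (by omega)).1 (by omega)
    obtain ⟨h7, h8⟩ := h.mul_lt hp hp0 h3 h4 (X + 1) (by omega)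
    rcases h5 with h5 | h5
    · have := Nat.mul_le_mul_left (X + 1) h5
      rw [mul_add] at this
      omega
    · have := Nat.mul_le_mul_left (X + 1) h5
      rw [mul_add] at this
      omega
  refine (Nat.div_mul_le_self _ _).trans (Nat.mul_le_mul_left d ?_)
  rw [cond_ble]
  split_ifs <;> omega

theorem scanNext_sound {M P p d w w' : ℕ} {L : List ℕ} {ih : ℕ → List ℕ → Bool} (hdw : d ≤ w)
    (hih : ∀ w L, d ≤ w → ih w L = true → ScanSpec M P p d w L)
    (hj : ∀ q, Good M d p q → (w + 1) * p ≤ d * q → w' * p ≤ d * q)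
    (h : scanNext ih w w' L = true) : ScanSpec M P p d (w + 1) L := by
  rw [scanNext, cond_ble] at h
  split_ifs at h with hle
  · exact hih _ _ (by omega) h
  · exact (hih _ _ (by omega) h).of_jump (by omega) hj

/-- Beyond `t * p` the distance only grows with `q`, so `g` bounds it from below until `t * p + M`.
Before `t * p` the distance shrinks, so the jump stops at `t * p - c`, below which it is at least `c
+ 1`. Any value of `c` is sound here. -/
theorem scanJump_sound {M P p d A w q e t g : ℕ} {L : List ℕ} {ih : ℕ → List ℕ → Bool}
    (hdw : d ≤ w) (hih : ∀ w L, d ≤ w → ih w L = true → ScanSpec M P p d w L)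
    (hp : p = M + d) (hp0 : 0 < p) (hA : A + 1 = (M + 1) * p) (hq : d * q < (w + 1) * p)
    (ht : t * p ≤ q + M) (hg : g = (q - t * p) + (t * p - q)) (hg0 : 0 < g)
    (h : scanJump M p d A ih w L q e (t * p) g = true) : ScanSpec M P p d (w + 1) L := by
  have hlt : ∀ x, (w + 1) * p ≤ d * x → q < x := fun x hx =>
    lt_of_mul_lt_mul_left (hq.trans_le hx) (Nat.zero_le d)
  rw [scanJump, cond_ble] at h
  simp only [forceNat_eq] at h
  split_ifs at h with hle
  · refine scanNext_sound hdw hih (fun x hx hwx => ?_) h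
    have := hlt x hwx
    refine scanStop_mul_le (t := t) hp hp0 hA hg0 hx fun hx' => ?_
    rw [Nat.add_eq, Nat.succ_eq_add_one] at hx'
    omega
  · refine scanNext_sound hdw hih (fun x hx hwx => ?_) h
    have := hlt x hwx
    refine scanStop_mul_le (t := t) hp hp0 hA (Nat.succ_pos _) hx fun hx' => ?_
    rw [Nat.sub_eq] at hx'
    omega

theorem scanTest_iff {M P p u x q : ℕ} :
    scanTest M P p u x q = true ↔ u + M < x ∧ x < u + p ∧ coprimeTest P q = true := by
  rw [scanTest, cond_ble, cond_ble, Nat.add_eq, Nat.add_eq]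
  split_ifs <;> simp_all

/-- The unique candidate of index `w` is decided by the drift bound and the two end conditions of
`good_iff`; either outcome reduces the claim to index `w + 1`. -/
theorem scanAt_sound {M P p d A w : ℕ} {L : List ℕ} {ih : ℕ → List ℕ → Bool}
    (hp : p = M + d) (hd : 0 < d) (hdM : d ≤ M + 1) (hA : A + 1 = (M + 1) * p) (hdw : d ≤ w)
    (hih : ∀ w L, d ≤ w → ih w L = true → ScanSpec M P p d w L)
    (h : scanAt M P p d A ih w L = true) : ScanSpec M P p d w L := by
  have hp0 : 0 < p := by omega
  rw [scanAt, cond_ble] at h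
  split_ifs at h with hw
  · rw [List.isEmpty_iff.1 h]
    exact scanSpec_nil hp0 hw
  rw [forceNat_eq, forceNat_eq] at h
  change scanStep M P p d A ih w L (((w + 1) * p - 1) / d) (A / (((w + 1) * p - 1) / d))
    ((((w + 1) * p - 1) / d + ((w + 1) * p - 1) / d + p) / (p + p))
    (((((w + 1) * p - 1) / d + ((w + 1) * p - 1) / d + p) / (p + p)) * p) = true at h
  have hskip := fun (h : ScanSpec M P p d (w + 1) L) => h.skip hp hd
  have hcons := fun (L' : List ℕ) (h : ScanSpec M P p d (w + 1) L') => h.cons hp hd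
  have hq1 := Nat.div_mul_le_self ((w + 1) * p - 1) d
  have hq2 := Nat.lt_mul_div_succ ((w + 1) * p - 1) hd
  set q := ((w + 1) * p - 1) / d with hq
  have hwp : (w + 1) * p = w * p + p := Nat.succ_mul w p
  rw [mul_comm] at hq1
  rw [mul_add, mul_one] at hq2
  -- Maximality of `q` gives `d * q ≥ w * p + M`, and `w * p ≥ d * p` with `M > w ≥ 0` makes this
  -- larger than `d * p`.
  have hpq : p < q := by
    have := Nat.mul_le_mul_right p hdw
    exact lt_of_mul_lt_mul_left (show d * p < d * q by omega) (Nat.zero_le d)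
  have ht1 := Nat.div_mul_le_self (q + q + p) (p + p)
  have ht2 := Nat.lt_mul_div_succ (q + q + p) (show 0 < p + p by omega)
  set t := (q + q + p) / (p + p) with ht
  rw [mul_add] at ht1
  rw [mul_add, mul_one, mul_comm, mul_add] at ht2
  have hR1 := Nat.div_mul_le_self A q
  have hR2 := Nat.lt_mul_div_succ A (show 0 < q by omega)
  have hMw := Nat.mul_le_mul_right p (show w + 1 ≤ M by omega)
  have hMp : (M + 1) * p = M * p + p := Nat.succ_mul M p
  -- `A / q` is the largest `r` with `r * q < (M + 1) * p`; it is at least `d` because `w < M`. The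
  -- difference `e` is the number of steps of the progression.
  have hR3 : d ≤ A / q := (Nat.le_div_iff_mul_le (by omega)).2 (by omega)
  obtain ⟨e, he⟩ := Nat.exists_eq_add_of_le hR3
  rw [he] at h hR1 hR2
  rw [mul_comm] at hR2
  rw [scanStep, forceNat_eq, forceNat_eq, cond_ble, cond_ble,
    Nat.sub_eq, Nat.sub_eq, Nat.sub_eq, Nat.add_sub_cancel_left, Nat.add_eq] at h
  have hgood := good_iff (M := M) (d := d) (p := p) (q := q) (t := t) (w := w) (e := e) hp hpq
    (by omega) (by omega) (by omega) (by omega) (by omega) (by omega) (by omega)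
  split_ifs at h with hde hx
  -- The distance serves as a divisor in `scanStop`; it is positive because `d ≤ e * g` and `d > 0`.
  · have hg0 : 0 < (q - t * p) + (t * p - q) := by
      by_contra! hz
      rw [Nat.le_zero.1 hz] at hde
      have : Nat.mul e 0 = 0 := rfl
      omega
    refine hskip (scanJump_sound hdw hih hp hp0 hA (by omega) (by omega) rfl hg0 h) fun hG => ?_
    obtain ⟨h1, h2⟩ := hG.1.mul_lt (t := t) hp hp0 (by omega) (by omega) e (by omega)
    change d ≤ e * _ at hde
    rcases le_total q (t * p) with hle | hle
    · obtain ⟨s, hs⟩ := Nat.exists_eq_add_of_le hle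
      rw [hs, mul_add] at h2
      rw [show q - t * p + (t * p - q) = s by omega] at hde
      omega
    · obtain ⟨s, hs⟩ := Nat.exists_eq_add_of_le hle
      rw [hs, mul_add] at h1
      rw [show q - t * p + (t * p - q) = s by omega] at hde
      omega
  · refine hskip (hih _ _ (by omega) h) fun hG => ?_
    have h1 := (hgood.1 hG.1).1
    change d * q ≤ w * p + M at hx
    omega
  · change ¬ (d * q ≤ w * p + M) at hx
    rw [cond_eq_ite] at h
    simp only [scanTest_iff] at h
    change (if (w + e * t) * p + M < (d + e) * q ∧ (d + e) * q < (w + e * t) * p + p ∧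
      coprimeTest P q = true then _ else _) = true at h
    split_ifs at h with hT
    · obtain ⟨h1, h2, h3⟩ := hT
      rcases L with _ | ⟨a, L⟩
      · exact absurd h (by simp [scanTake])
      · rw [scanTake, cond_beq] at h
        split_ifs at h with haq
        rw [haq]
        exact hcons L (hih _ _ (by omega) h) (by omega) ⟨hgood.2 ⟨by omega, h1, h2⟩, h3⟩
    · refine hskip (hih _ _ (by omega) h) fun hG => ?_
      obtain ⟨-, h1, h2⟩ := hgood.1 hG.1
      exact hT ⟨h1, h2, hG.2⟩

/-- Soundness holds for any amount of fuel, since a scan that runs out of it returns `false`. -/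
theorem scan_sound {M P p d A fuel : ℕ} (hp : p = M + d) (hd : 0 < d) (hdM : d ≤ M + 1)
    (hA : A + 1 = (M + 1) * p) : ∀ (w : ℕ) (L : List ℕ), d ≤ w →
    scan M P p d A fuel w L = true → ScanSpec M P p d w L := by
  induction fuel with
  | zero => intro w L _ h; exact absurd h (by simp [scan])
  | succ fuel ih =>
    intro w L hdw h
    exact scanAt_sound hp hd hdM hA hdw ih h

/-- The scan may start at index `d`: a good `q` exceeds `p`, so `d * p ≤ d * q`. -/
theorem scanRow_sound {M P p : ℕ} {L : List ℕ} (hM : M < p) (hM' : p ≤ 2 * M + 1)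
    (h : scanRow M P p L = true) (q : ℕ) :
    q ∈ L ↔ Good M (p - M) p q ∧ coprimeTest P q = true := by
  have hA : (M + 1) * p - 1 + 1 = (M + 1) * p :=
    Nat.sub_add_cancel (Nat.mul_pos (Nat.succ_pos M) (by omega))
  have := scan_sound (P := P) (fuel := M + 1) (show p = M + (p - M) by omega) (by omega)
    (by omega) hA _ _ le_rfl h q
  rw [this]
  exact and_iff_right_of_imp fun h => Nat.mul_le_mul_left _ h.1.1.le

/-! ### From rows to tables. -/

/-- The pairs listed by a table of rows. -/
def rowPairs (rows : List (ℕ × List ℕ)) : List (ℕ × ℕ) :=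
  rows.flatMap fun r => r.2.map fun q => (r.1, q)

theorem mem_rowPairs_cons {r : ℕ × List ℕ} {rs : List (ℕ × List ℕ)} {p q : ℕ} :
    (p, q) ∈ rowPairs (r :: rs) ↔ (p = r.1 ∧ q ∈ r.2) ∨ (p, q) ∈ rowPairs rs := by
  simp [rowPairs, eq_comm, and_comm]

/-- `rows` lists the pairs `(x, q)` with `x` among the `n` numbers `p, p + 2, p + 4, …`, both
coprime to `P`, for which `q` is good. -/
def RowsSpec (M P n p : ℕ) (rows : List (ℕ × List ℕ)) : Prop :=
  ∀ x q, (x, q) ∈ rowPairs rows ↔ (∃ j < n, x = p + 2 * j) ∧ coprimeTest P x = true ∧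
    Good M (x - M) x q ∧ coprimeTest P q = true

theorem RowsSpec.skip {M P n p : ℕ} {rows : List (ℕ × List ℕ)} (h : RowsSpec M P n (p + 2) rows)
    (hp : ∀ q, ¬ (coprimeTest P p = true ∧ Good M (p - M) p q ∧ coprimeTest P q = true)) :
    RowsSpec M P (n + 1) p rows := by
  intro x q
  rw [h x q]
  constructor
  · rintro ⟨⟨j, hj, rfl⟩, h2⟩
    exact ⟨⟨j + 1, by omega, by omega⟩, h2⟩
  · rintro ⟨⟨j, hj, rfl⟩, h2⟩
    rcases j with _ | j
    · exact absurd h2 (hp q)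
    · exact ⟨⟨j, by omega, by omega⟩, h2⟩

theorem RowsSpec.cons {M P n p : ℕ} {r : ℕ × List ℕ} {rows : List (ℕ × List ℕ)}
    (h : RowsSpec M P n (p + 2) rows) (hr : r.1 = p) (hp : coprimeTest P p = true)
    (hq : ∀ q, q ∈ r.2 ↔ Good M (p - M) p q ∧ coprimeTest P q = true) :
    RowsSpec M P (n + 1) p (r :: rows) := by
  intro x q
  rw [mem_rowPairs_cons, h x q, hr, hq q]
  constructor
  · rintro (⟨rfl, h2⟩ | ⟨⟨j, hj, rfl⟩, h2⟩)
    · exact ⟨⟨0, by omega, rfl⟩, hp, h2⟩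
    · exact ⟨⟨j + 1, by omega, by omega⟩, h2⟩
  · rintro ⟨⟨j, hj, rfl⟩, h2⟩
    rcases j with _ | j
    · exact Or.inl ⟨rfl, h2.2⟩
    · exact Or.inr ⟨⟨j, by omega, by omega⟩, h2⟩

/-- The bound on `p + 2 * n` keeps every examined number at most `2 * M + 1`. Then half of it does
not exceed `M`, which is what the nearest-multiple argument of the scan needs. -/
theorem rowsCheck_sound {M P n : ℕ} : ∀ {p : ℕ} {rows : List (ℕ × List ℕ)}, M < p →
    p + 2 * n ≤ 2 * M + 3 → rowsCheck M P n p rows = true → RowsSpec M P n p rows := by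
  induction n with
  | zero =>
    intro p rows _ _ h x q
    rw [List.isEmpty_iff.1 h]
    simp [rowPairs]
  | succ n ih =>
    intro p rows hM hn h
    change (bif coprimeTest P p then rowsNext M P p (rowsCheck M P n) rows
      else rowsCheck M P n (p + 2) rows) = true at h
    have ih' := fun rows => ih (p := p + 2) (rows := rows) (by omega) (by omega)
    rw [cond_eq_ite] at h
    split_ifs at h with hp
    · rcases rows with _ | ⟨r, rs⟩
      · rw [rowsNext, cond_eq_ite] at h
        split_ifs at h with h1
        refine (ih' _ h).skip fun q hq => ?_
        exact List.not_mem_nil ((scanRow_sound hM (by omega) h1 q).2 hq.2)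
      · rw [rowsNext, cond_beq] at h
        simp only [cond_eq_ite] at h
        split_ifs at h with h1 h2 h2
        · exact (ih' _ h).cons h1 hp fun q => scanRow_sound hM (by omega) h2 q
        · refine (ih' _ h).skip fun q hq => ?_
          exact List.not_mem_nil ((scanRow_sound hM (by omega) h2 q).2 hq.2)
    · exact (ih' _ h).skip fun q hq => hp hq.1

/-- `rows` lists the pairs of primes `p < q`, `a ≤ p < b`, such that `2 ^ k * p * q` is weird. -/
def TableSpec (k a b : ℕ) (rows : List (ℕ × List ℕ)) : Prop :=
  ∀ p q, (p, q) ∈ rowPairs rows ↔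
    (a ≤ p ∧ p < b) ∧ p.Prime ∧ q.Prime ∧ p < q ∧ (2 ^ k * p * q).Weird

theorem TableSpec.append {k a b c : ℕ} {rows rows' : List (ℕ × List ℕ)} (h : TableSpec k a b rows)
    (h' : TableSpec k b c rows') (hab : a ≤ b) (hbc : b ≤ c) : TableSpec k a c (rows ++ rows') := by
  intro p q
  have e : rowPairs (rows ++ rows') = rowPairs rows ++ rowPairs rows' := List.flatMap_append
  rw [e, List.mem_append, h p q, h' p q, ← or_and_right]
  refine and_congr_left fun _ => ?_
  omega

theorem tableCheck_sound {k p n : ℕ} {rows : List (ℕ × List ℕ)}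
    (h : tableCheck k p n rows = true) (hk : 1 ≤ k) (hpo : Odd p) (hp : 2 ^ (k + 1) < p)
    (hn : p + 2 * n ≤ 2 * 2 ^ (k + 1) + 1) : TableSpec k p (p + 2 * n) rows := by
  have h' : rowsCheck (2 ^ (k + 1) - 1) (prodRange 1 (k + 1)) n p rows = true := h
  rw [prodRange_eq_ascFactorial, Nat.one_ascFactorial] at h'
  -- With `N = 2 ^ (k + 1) ≥ 4`, the numbers `x ≤ 2 * N` lie below `N * N`, the range of the
  -- primality test.
  have hN : 4 ≤ 2 ^ (k + 1) := by
    calc 4 = 2 ^ (1 + 1) := by norm_num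
      _ ≤ 2 ^ (k + 1) := Nat.pow_le_pow_right (by norm_num) (by omega)
  have hNe : 2 ^ (k + 1) = 2 * 2 ^ k := pow_succ' 2 k
  have hspec := rowsCheck_sound (by omega) (by omega) h'
  intro x q
  rw [hspec x q]
  have hrange : Odd x → ((∃ j < n, x = p + 2 * j) ↔ p ≤ x ∧ x < p + 2 * n) := by
    intro hx
    constructor
    · rintro ⟨j, hj, rfl⟩; omega
    · rintro ⟨h1, h2⟩
      obtain ⟨u, hu⟩ := hx
      obtain ⟨v, hv⟩ := hpo
      exact ⟨u - v, by omega, by omega⟩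
  have hxprime : p ≤ x → x < p + 2 * n →
      (coprimeTest (2 ^ (k + 1)).factorial x = true ↔ x.Prime) := fun h1 h2 =>
    coprimeTest_factorial_iff (by omega) (by omega) (by nlinarith)
  have hqprime : p ≤ x → x < p + 2 * n → Odd x →
      Good (2 ^ (k + 1) - 1) (x - (2 ^ (k + 1) - 1)) x q →
      (coprimeTest (2 ^ (k + 1)).factorial q = true ↔ q.Prime) := by
    rintro h1 h2 ⟨u, hu⟩ ⟨h3, h4, -⟩
    -- As `x > N`, the excess `d` is at least `2`; so `2 * q ≤ d * q ≤ M * x < 2 * N * N` puts `q`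
    -- below `N * N` as well.
    have h5 : 2 ≤ x - (2 ^ (k + 1) - 1) := by omega
    have h6 := Nat.mul_le_mul_right q h5
    refine coprimeTest_factorial_iff (by omega) (by omega) ?_
    have h7 : (2 ^ (k + 1) - 1) * x ≤ 2 ^ (k + 1) * x := Nat.mul_le_mul_right x (Nat.sub_le _ 1)
    have h8 : 2 ^ (k + 1) * x ≤ 2 ^ (k + 1) * (2 * 2 ^ (k + 1)) :=
      Nat.mul_le_mul_left _ (by omega)
    have h9 : x < 2 * 2 ^ (k + 1) := by omega
    have h10 : 2 ^ (k + 1) * x < 2 ^ (k + 1) * (2 * 2 ^ (k + 1)) :=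
      Nat.mul_lt_mul_of_pos_left h9 (by omega)
    have h11 : 2 ^ (k + 1) * (2 * 2 ^ (k + 1)) = 2 * (2 ^ (k + 1) * 2 ^ (k + 1)) := by ring
    omega
  constructor
  · rintro ⟨⟨j, hj, hx⟩, h1, h2, h3⟩
    have hx1 : p ≤ x ∧ x < p + 2 * n := by omega
    have hxo : Odd x := by
      rw [hx]
      exact hpo.add_even (even_two_mul j)
    have hxp := (hxprime hx1.1 hx1.2).1 h1
    have hqp := (hqprime hx1.1 hx1.2 hxo h2).1 h3
    have hqo : Odd q := hqp.odd_of_ne_two (by have := h2.1; omega)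
    exact ⟨hx1, hxp, hqp, h2.1,
      (weird_two_pow_mul_mul_iff_good hxp hqp hxo hqo h2.1).2 ⟨by omega, h2⟩⟩
  · rintro ⟨hx1, hxp, hqp, hlt, hw⟩
    have hxo : Odd x := hxp.odd_of_ne_two (by omega)
    have hqo : Odd q := hqp.odd_of_ne_two (by omega)
    have hG := ((weird_two_pow_mul_mul_iff_good hxp hqp hxo hqo hlt).1 hw).2
    exact ⟨(hrange hxo).2 hx1, (hxprime hx1.1 hx1.2).2 hxp, hG, (hqprime hx1.1 hx1.2 hxo hG).2 hqp⟩

/-- The range in the hypothesis is exhaustive: weirdness gives `2 ^ (k + 1) ≤ p`, with equality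
excluded by parity, and `Good.lt` gives the upper bound. Primitivity is automatic. -/
theorem TableSpec.mem_weirdTable_iff {k : ℕ}
    (h : TableSpec k (2 ^ (k + 1) + 1) (2 * 2 ^ (k + 1) + 1) (weirdRows k)) (p q : ℕ) :
    (p, q) ∈ weirdTable k ↔
      p.Prime ∧ q.Prime ∧ Odd p ∧ Odd q ∧ p < q ∧ PrimitiveWeird (2 ^ k * p * q) := by
  have hN : 2 ^ (k + 1) = 2 * 2 ^ k := pow_succ' 2 k
  have hN' : 0 < 2 ^ k := by positivity
  refine (h p q).trans ?_
  constructor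
  · rintro ⟨⟨_, _⟩, hp, hq, hlt, hw⟩
    have hpo : Odd p := hp.odd_of_ne_two (by omega)
    have hqo : Odd q := hq.odd_of_ne_two (by omega)
    exact ⟨hp, hq, hpo, hqo, hlt, hw.primitiveWeird_two_pow_mul_mul hp hq hpo hqo hlt⟩
  · rintro ⟨hp, hq, hpo, hqo, hlt, hw⟩
    refine ⟨?_, hp, hq, hlt, hw.1⟩
    obtain ⟨h1, h2⟩ := (weird_two_pow_mul_mul_iff_good hp hq hpo hqo hlt).1 hw.1
    have h3 := h2.lt (by omega)
    obtain ⟨u, hu⟩ := hpo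
    omega

/-! ### Counting. -/

theorem primes_eq_of_mul_eq {p q p' q' : ℕ} (hp : p.Prime) (hp' : p'.Prime)
    (hq' : q'.Prime) (h : p < q) (h' : p' < q') (he : p * q = p' * q') : p = p' ∧ q = q' := by
  have hd : p ∣ p' * q' := he ▸ dvd_mul_right p q
  rcases (hp.dvd_mul).1 hd with hd | hd
  · have := (Nat.prime_dvd_prime_iff_eq hp hp').1 hd
    subst this
    exact ⟨rfl, Nat.eq_of_mul_eq_mul_left hp.pos he⟩
  · have := (Nat.prime_dvd_prime_iff_eq hp hq').1 hd
    subst this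
    rw [mul_comm p' p] at he
    have := Nat.eq_of_mul_eq_mul_left hp.pos he
    omega

/-- A numerical key for pairs, injective on the tables. -/
def pairKey (x : ℕ × ℕ) : ℕ := Nat.add (Nat.mul x.1 4294967296) x.2

/-- Checks that the keys of `L` are increasing and greater than `b`, and that `L` has `N - c`
elements. -/
def countCheck (N : ℕ) (L : List (ℕ × ℕ)) : ℕ → ℕ → Bool :=
  List.rec (fun _ c => Nat.beq c N) (fun x _ ih b c => forceNat (pairKey x) fun y =>
    bif Nat.ble y b then false else forceNat (Nat.succ c) fun c' => ih y c') L

theorem countCheck_cons (N : ℕ) (x : ℕ × ℕ) (L : List (ℕ × ℕ)) (b c : ℕ) :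
    countCheck N (x :: L) b c =
      bif Nat.ble (pairKey x) b then false else countCheck N L (pairKey x) (c + 1) := by
  have h : countCheck N (x :: L) b c = forceNat (pairKey x) fun y =>
      bif Nat.ble y b then false else forceNat (Nat.succ c) fun c' => countCheck N L y c' := rfl
  rw [h, forceNat_eq, forceNat_eq]

/-- Strictly increasing keys exclude repetitions, so a single pass certifies both the length and the
distinctness of the entries. -/
theorem countCheck_sound {N : ℕ} {L : List (ℕ × ℕ)} : ∀ {b c : ℕ}, countCheck N L b c = true →
    c + L.length = N ∧ (∀ x ∈ L, b < pairKey x) ∧ L.Nodup := by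
  induction L with
  | nil =>
    intro b c h
    have : c = N := Nat.eq_of_beq_eq_true h
    simpa using this
  | cons x L ih =>
    intro b c h
    rw [countCheck_cons, cond_ble] at h
    split_ifs at h with hb
    obtain ⟨h1, h2, h3⟩ := ih h
    refine ⟨by rw [List.length_cons]; omega, fun y hy => ?_, List.nodup_cons.2 ⟨fun hx => ?_, h3⟩⟩
    · rcases List.mem_cons.1 hy with rfl | hy
      · omega
      · exact (not_le.1 hb).trans (h2 y hy)
    · exact lt_irrefl _ (h2 x hx)

/-- Unique factorization makes `(p, q) ↦ 2 ^ k * p * q` injective on pairs of primes `p < q`, so the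
number of values is the length of a table without repetitions. -/
theorem ncard_primitiveWeirdTwoPowMul {k N : ℕ}
    (h : ∀ p q : ℕ, (p, q) ∈ weirdTable k ↔
      p.Prime ∧ q.Prime ∧ Odd p ∧ Odd q ∧ p < q ∧ PrimitiveWeird (2 ^ k * p * q))
    (hs : countCheck N (weirdTable k) 0 0 = true) :
    (primitiveWeirdTwoPowMul k).ncard = N := by
  obtain ⟨hlen, -, hnd⟩ := countCheck_sound hs
  rw [Nat.zero_add] at hlen
  have himg : primitiveWeirdTwoPowMul k =
      (fun x : ℕ × ℕ => 2 ^ k * x.1 * x.2) '' ((weirdTable k).toFinset : Set (ℕ × ℕ)) := by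
    ext n
    simp only [primitiveWeirdTwoPowMul, Set.mem_ofPred_eq, Set.mem_image, List.coe_toFinset,
      Prod.exists, h]
    constructor
    · rintro ⟨hn, p, q, hp, hq, hpo, hqo, hlt, rfl⟩
      exact ⟨p, q, ⟨hp, hq, hpo, hqo, hlt, hn⟩, rfl⟩
    · rintro ⟨p, q, ⟨hp, hq, hpo, hqo, hlt, hn⟩, rfl⟩
      exact ⟨hn, p, q, hp, hq, hpo, hqo, hlt, rfl⟩
  rw [himg, Set.InjOn.ncard_image, Set.ncard_coe_finset, List.toFinset_card_of_nodup hnd, hlen]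
  rintro ⟨p, q⟩ hx ⟨p', q'⟩ hy he
  simp only [List.coe_toFinset, Set.mem_ofPred_eq, h] at hx hy
  dsimp only at he
  rw [mul_assoc, mul_assoc] at he
  obtain ⟨h1, h2⟩ := primes_eq_of_mul_eq hx.1 hy.1 hy.2.1 hx.2.2.2.2.1 hy.2.2.2.2.1
    (Nat.eq_of_mul_eq_mul_left (by positivity) he)
  rw [h1, h2]

/-! ### Evaluation of the checks, range by range. -/

/-- The argument `n` is half the length of the range of `p`, as only odd `p` are visited. -/
theorem TableSpec.of_check {k p b : ℕ} {rows : List (ℕ × List ℕ)} (n : ℕ)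
    (hs : 1 ≤ k ∧ p % 2 = 1 ∧ 2 ^ (k + 1) < p ∧ b ≤ 2 * 2 ^ (k + 1) + 1 ∧ b = p + 2 * n)
    (h : tableCheck k p n rows = true) : TableSpec k p b rows := by
  obtain ⟨h1, h2, h3, h4, rfl⟩ := hs
  exact tableCheck_sound h h1 (Nat.odd_iff.2 h2) h3 h4

theorem tableSpec_weirdRows1 : TableSpec 1 5 9 weirdRows1 :=
  .of_check 2 (by norm_num) (by decide +kernel)

theorem tableSpec_weirdRows2 : TableSpec 2 9 17 weirdRows2 :=
  .of_check 4 (by norm_num) (by decide +kernel)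

theorem tableSpec_weirdRows3 : TableSpec 3 17 33 weirdRows3 :=
  .of_check 8 (by norm_num) (by decide +kernel)

theorem tableSpec_weirdRows4 : TableSpec 4 33 65 weirdRows4 :=
  .of_check 16 (by norm_num) (by decide +kernel)

theorem tableSpec_weirdRows5 : TableSpec 5 65 129 weirdRows5 :=
  .of_check 32 (by norm_num) (by decide +kernel)

theorem tableSpec_weirdRows6 : TableSpec 6 129 257 weirdRows6 :=
  .of_check 64 (by norm_num) (by decide +kernel)

theorem tableSpec_weirdRows7 : TableSpec 7 257 513 weirdRows7 :=
  .of_check 128 (by norm_num) (by decide +kernel)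

theorem tableSpec_weirdRows8 : TableSpec 8 513 1025 weirdRows8 :=
  .of_check 256 (by norm_num) (by decide +kernel)

theorem tableSpec_weirdRows9 : TableSpec 9 1025 2049 weirdRows9 :=
  .of_check 512 (by norm_num) (by decide +kernel)

theorem tableSpec_weirdRows10 : TableSpec 10 2049 4097 weirdRows10 :=
  .of_check 1024 (by norm_num) (by decide +kernel)

theorem tableSpec_weirdRows11Part1 : TableSpec 11 4097 7451 weirdRows11Part1 :=
  .of_check 1677 (by norm_num) (by decide +kernel)

theorem tableSpec_weirdRows11Part2 : TableSpec 11 7451 8193 weirdRows11Part2 :=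
  .of_check 371 (by norm_num) (by decide +kernel)

theorem tableSpec_weirdRows12Part1 : TableSpec 12 8193 10453 weirdRows12Part1 :=
  .of_check 1130 (by norm_num) (by decide +kernel)

theorem tableSpec_weirdRows12Part2 : TableSpec 12 10453 16273 weirdRows12Part2 :=
  .of_check 2910 (by norm_num) (by decide +kernel)

theorem tableSpec_weirdRows12Part3 : TableSpec 12 16273 16385 weirdRows12Part3 :=
  .of_check 56 (by norm_num) (by decide +kernel)

theorem tableSpec_weirdRows13Part1 : TableSpec 13 16385 18191 weirdRows13Part1 :=
  .of_check 903 (by norm_num) (by decide +kernel)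

theorem tableSpec_weirdRows13Part2 : TableSpec 13 18191 21739 weirdRows13Part2 :=
  .of_check 1774 (by norm_num) (by decide +kernel)

theorem tableSpec_weirdRows13Part3 : TableSpec 13 21739 27983 weirdRows13Part3 :=
  .of_check 3122 (by norm_num) (by decide +kernel)

theorem tableSpec_weirdRows13Part4 : TableSpec 13 27983 32769 weirdRows13Part4 :=
  .of_check 2393 (by norm_num) (by decide +kernel)

theorem tableSpec_weirdRows14Part1 : TableSpec 14 32769 34429 weirdRows14Part1 :=
  .of_check 830 (by norm_num) (by decide +kernel)

theorem tableSpec_weirdRows14Part2 : TableSpec 14 34429 37139 weirdRows14Part2 :=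
  .of_check 1355 (by norm_num) (by decide +kernel)

theorem tableSpec_weirdRows14Part3 : TableSpec 14 37139 40849 weirdRows14Part3 :=
  .of_check 1855 (by norm_num) (by decide +kernel)

theorem tableSpec_weirdRows14Part4 : TableSpec 14 40849 46457 weirdRows14Part4 :=
  .of_check 2804 (by norm_num) (by decide +kernel)

theorem tableSpec_weirdRows14Part5 : TableSpec 14 46457 51059 weirdRows14Part5 :=
  .of_check 2301 (by norm_num) (by decide +kernel)

theorem tableSpec_weirdRows14Part6 : TableSpec 14 51059 63211 weirdRows14Part6 :=
  .of_check 6076 (by norm_num) (by decide +kernel)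

theorem tableSpec_weirdRows14Part7 : TableSpec 14 63211 65537 weirdRows14Part7 :=
  .of_check 1163 (by norm_num) (by decide +kernel)

/-! ### Gluing consecutive ranges of `p` and assembling the theorem. -/

theorem tableSpec_weirdRows11 : TableSpec 11 4097 8193 weirdRows11 := by
  have h := tableSpec_weirdRows11Part1
  exact h.append tableSpec_weirdRows11Part2 (by norm_num) (by norm_num)

theorem tableSpec_weirdRows12 : TableSpec 12 8193 16385 weirdRows12 := by
  have h := tableSpec_weirdRows12Part1
  replace h := h.append tableSpec_weirdRows12Part2 (by norm_num) (by norm_num)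
  exact h.append tableSpec_weirdRows12Part3 (by norm_num) (by norm_num)

theorem tableSpec_weirdRows13 : TableSpec 13 16385 32769 weirdRows13 := by
  have h := tableSpec_weirdRows13Part1
  replace h := h.append tableSpec_weirdRows13Part2 (by norm_num) (by norm_num)
  replace h := h.append tableSpec_weirdRows13Part3 (by norm_num) (by norm_num)
  exact h.append tableSpec_weirdRows13Part4 (by norm_num) (by norm_num)

theorem tableSpec_weirdRows14 : TableSpec 14 32769 65537 weirdRows14 := by
  have h := tableSpec_weirdRows14Part1
  replace h := h.append tableSpec_weirdRows14Part2 (by norm_num) (by norm_num)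
  replace h := h.append tableSpec_weirdRows14Part3 (by norm_num) (by norm_num)
  replace h := h.append tableSpec_weirdRows14Part4 (by norm_num) (by norm_num)
  replace h := h.append tableSpec_weirdRows14Part5 (by norm_num) (by norm_num)
  replace h := h.append tableSpec_weirdRows14Part6 (by norm_num) (by norm_num)
  exact h.append tableSpec_weirdRows14Part7 (by norm_num) (by norm_num)

theorem tableSpec_weirdRows {k : ℕ} (hk : 1 ≤ k) (hk' : k ≤ 14) :
    TableSpec k (2 ^ (k + 1) + 1) (2 * 2 ^ (k + 1) + 1) (weirdRows k) := by
  interval_cases k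
  · exact tableSpec_weirdRows1
  · exact tableSpec_weirdRows2
  · exact tableSpec_weirdRows3
  · exact tableSpec_weirdRows4
  · exact tableSpec_weirdRows5
  · exact tableSpec_weirdRows6
  · exact tableSpec_weirdRows7
  · exact tableSpec_weirdRows8
  · exact tableSpec_weirdRows9
  · exact tableSpec_weirdRows10
  · exact tableSpec_weirdRows11
  · exact tableSpec_weirdRows12
  · exact tableSpec_weirdRows13
  · exact tableSpec_weirdRows14

theorem mem_weirdTable_iff {k : ℕ} (hk : 1 ≤ k) (hk' : k ≤ 14) (p q : ℕ) :
    (p, q) ∈ weirdTable k ↔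
      p.Prime ∧ q.Prime ∧ Odd p ∧ Odd q ∧ p < q ∧ PrimitiveWeird (2 ^ k * p * q) :=
  (tableSpec_weirdRows hk hk').mem_weirdTable_iff p q

theorem ncard_of_countCheck {k N : ℕ} (hk : 1 ≤ k ∧ k ≤ 14)
    (hs : countCheck N (weirdTable k) 0 0 = true) : (primitiveWeirdTwoPowMul k).ncard = N :=
  ncard_primitiveWeirdTwoPowMul (mem_weirdTable_iff hk.1 hk.2) hs

theorem mainTheorem3 :
    -- completeness and correctness of the tables, for `1 ≤ k ≤ 14`
    (∀ k : ℕ, 1 ≤ k → k ≤ 14 → ∀ p q : ℕ,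
      (p, q) ∈ weirdTable k ↔
        p.Prime ∧ q.Prime ∧ Odd p ∧ Odd q ∧ p < q ∧ PrimitiveWeird (2 ^ k * p * q)) ∧
    -- the number of such primitive weird numbers, for `1 ≤ k ≤ 14`
    (primitiveWeirdTwoPowMul 1).ncard = 1 ∧
    (primitiveWeirdTwoPowMul 2).ncard = 1 ∧
    (primitiveWeirdTwoPowMul 3).ncard = 5 ∧
    (primitiveWeirdTwoPowMul 4).ncard = 3 ∧
    (primitiveWeirdTwoPowMul 5).ncard = 10 ∧
    (primitiveWeirdTwoPowMul 6).ncard = 23 ∧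
    (primitiveWeirdTwoPowMul 7).ncard = 29 ∧
    (primitiveWeirdTwoPowMul 8).ncard = 53 ∧
    (primitiveWeirdTwoPowMul 9).ncard = 115 ∧
    (primitiveWeirdTwoPowMul 10).ncard = 210 ∧
    (primitiveWeirdTwoPowMul 11).ncard = 394 ∧
    (primitiveWeirdTwoPowMul 12).ncard = 683 ∧
    (primitiveWeirdTwoPowMul 13).ncard = 1389 ∧
    (primitiveWeirdTwoPowMul 14).ncard = 3118 ∧
    -- weird numbers of this form are primitive, for every `k ≥ 1`
    (∀ k p q : ℕ, 1 ≤ k → p.Prime → q.Prime → Odd p → Odd q → p < q →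
      (2 ^ k * p * q).Weird → PrimitiveWeird (2 ^ k * p * q)) ∧
    -- numbers `2 ^ k * p ^ m` are never weird
    (∀ k p m : ℕ, 1 ≤ k → 1 ≤ m → p.Prime → Odd p → ¬ (2 ^ k * p ^ m).Weird) := by
  refine ⟨fun k hk hk' p q => mem_weirdTable_iff hk hk' p q, ?_, ?_, ?_, ?_, ?_, ?_, ?_,
    ?_, ?_, ?_, ?_, ?_, ?_, ?_,
    fun k p q _ hp hq hpo hqo hlt hw => hw.primitiveWeird_two_pow_mul_mul hp hq hpo hqo hlt,
    fun k p m _ _ hp hpo => not_weird_two_pow_mul_pow m hp hpo⟩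
  all_goals exact ncard_of_countCheck (by norm_num) (by decide +kernel)
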